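/- Corollary 4.7 (cor:catO). **Root data.** Let $I$ be a finite set with a total order $<$ and a symmetric bilinear form $\cdot$ on $\mathbb Z[I]$ with values in $\mathbb Z$ such that $d_i=\frac{i\cdot i}{2}\in\mathbb Z_{>0}$ and $a_{ij}=\frac{2\,i\cdot j}{i\cdot i}\in\mathbb Z$ for all $i,j\in I$, and $a_{ij}\le 0$ for $i\ne j$. Let $p:I\to\{0,1\}$ be a parity function such that $a_{ij}\in 2\mathbb Z$ for all $j\in I$ if $p(i)=1$, and $d_i\equiv p(i) \bmod 2$ for all $i$ (a bar-consistent super Cartan datum of anisotropic type). Let $Y,X$ be finitely generated free abelian groups with a perfect pairing $\langle\cdot,\cdot\rangle:Y\times X\to\mathbb Z$ and with linearly independent families $(i)_{i\in I}$ in $Y$ and $(i')_{i\in I}$ in $X$ such that $\langle i,j'\rangle=a_{ij}$. Put $b_{ij}=1-a_{ij}$. **Scalars.** Let $\pi^2=1$, $\mathbf t^2=-1$, and write $R^\pi=R[\pi]/(\pi^2-1)$, $v_i=v^{d_i}$, $\pi_i=\pi^{d_i}$. For $n\in\mathbb Z$, $k\ge 0$ let $$[n]_{v_i,\pi_i}=\frac{(\pi_iv_i)^n-v_i^{-n}}{\pi_iv_i-v_i^{-1}},\qquad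 \begin{bmatrix}n\\k\end{bmatrix}_{v_i,\pi_i}=\frac{\prod_{l=n-k+1}^{n}\big((\pi_iv_i)^l-v_i^{-l}\big)}{\prod_{l=1}^{k}\big((\pi_iv_i)^l-v_i^{-l}\big)},\qquad c_{ij}(k)=(-1)^k\pi^{\binom k2p(i)+kp(i)p(j)}\begin{bmatrix}b_{ij}\\k\end{bmatrix}_{v_i,\pi_i}.$$ **The covering quantum group** $\mathbf U$ is the $\mathbb Q(v)^\pi$-algebra with generators $E_i,F_i$ ($i\in I$), $K_\mu,J_\mu$ ($\mu\in Y$) and relations $J_\mu J_\nu=J_{\mu+\nu}$, $K_\mu K_\nu=K_{\mu+\nu}$, $K_0=J_0=J_\nu^2=1$, $J_\mu K_\nu=K_\nu J_\mu$, $J_\mu E_i=\pi^{\langle\mu,i'\rangle}E_iJ_\mu$, $J_\mu F_i=\pi^{-\langle\mu,i'\rangle}F_iJ_\mu$, $K_\mu E_i=v^{\langle\mu,i'\rangle}E_iK_\mu$, $K_\mu F_i=v^{-\langle\mu,i'\rangle}F_iK_\mu$, $$E_iF_j-\pi^{p(i)p(j)}F_jE_i=\delta_{ij}\frac{J_{d_ii}K_{d_ii}-K_{-d_ii}}{\pi_iv_i-v_i^{-1}},$$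 $$\sum_{k=0}^{b_{ij}}c_{ij}(k)\,E_i^{b_{ij}-k}E_jE_i^k=0=\sum_{k=0}^{b_{ij}}c_{ij}(k)\,F_i^{b_{ij}-k}F_jF_i^k\quad(i\ne j).$$ Put $\mathbf U[\mathbf t]=\mathbb Q(v,\mathbf t)^\pi\otimes_{\mathbb Q(v)^\pi}\mathbf U$. For $\varepsilon=\pm1$ let $\mathbf U[\mathbf t]|_{\pi=\varepsilon}=\mathbb Q(v,\mathbf t)\otimes_{\mathbb Q(v,\mathbf t)^\pi}\mathbf U[\mathbf t]$, where $\pi$ acts on $\mathbb Q(v,\mathbf t)$ as $\varepsilon$. This is the quantum group for $\varepsilon=1$ and the quantum supergroup for $\varepsilon=-1$. **The modified covering quantum group** $\dot{\mathbf U}$ is the associative $\mathbb Q(v)^\pi$-algebra without unit with generators $1_\lambda,E_i1_\lambda,F_i1_\lambda$ ($\lambda\in X$, $i\in I$) and relations $1_\lambda1_{\lambda'}=\delta_{\lambda,\lambda'}1_\lambda$, $(E_i1_\lambda)1_{\lambda'}=\delta_{\lambda,\lambda'}E_i1_\lambda$, $1_{\lambda'}(E_i1_\lambda)=\delta_{\lambda',\lambda+i'}E_i1_\lambda$,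 $(F_i1_\lambda)1_{\lambda'}=\delta_{\lambda,\lambda'}F_i1_\lambda$, $1_{\lambda'}(F_i1_\lambda)=\delta_{\lambda',\lambda-i'}F_i1_\lambda$, $$(E_i1_{\lambda-j'})(F_j1_\lambda)-\pi^{p(i)p(j)}(F_j1_{\lambda+i'})(E_i1_\lambda)=\delta_{ij}[\langle i,\lambda\rangle]_{v_i,\pi_i}1_\lambda,$$ $$\sum_{k=0}^{b_{ij}}c_{ij}(k)\,E_i^{b_{ij}-k}E_jE_i^k1_\lambda=0=\sum_{k=0}^{b_{ij}}c_{ij}(k)\,F_i^{b_{ij}-k}F_jF_i^k1_\lambda\quad(i\neq j),$$ where $E_i^{b_{ij}-k}E_jE_i^k1_\lambda$ stands for the product of the generators $E_i1_\mu$, $E_j1_\mu$ with the appropriate weights $\mu$ (and similarly for $F$). Put $\dot{\mathbf U}[\mathbf t]=\mathbb Q(v,\mathbf t)^\pi\otimes_{\mathbb Q(v)^\pi}\dot{\mathbf U}$. **Category $\mathcal O$.** The weight spaces of a $\mathbf U[\mathbf t]|_{\pi=\varepsilon}$-module $M$ are $M_\lambda=\{m\in M: K_\nu m=v^{\langle\nu,\lambda\rangle}m,\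 J_\nu m=\varepsilon^{\langle\nu,\lambda\rangle}m\ \ \forall\nu\in Y\}$, $\lambda\in X$, and $M$ is a weight module if $M=\bigoplus_{\lambda\in X}M_\lambda$. The BGG category $\mathcal O^{\mathbf t}_{\pi=\varepsilon}$ is the full subcategory of the category of $\mathbf U[\mathbf t]|_{\pi=\varepsilon}$-modules whose objects are the weight modules $M$ with all $M_\lambda$ finite-dimensional over $\mathbb Q(v,\mathbf t)$ and all weights in a finite union of sets of the form $\lambda-\sum_{i\in I}\mathbb Z_{\ge0}\,i'$. On a weight module $M$ the algebra $\dot{\mathbf U}[\mathbf t]$ acts as follows: scalars act through $\pi\mapsto\varepsilon$, $1_\lambda$ acts as the projection onto $M_\lambda$, and $E_i1_\lambda$, $F_i1_\lambda$ act as $E_i$, $F_i$ preceded by this projection. **The form $\dot\phi$.** Let $\phi$ be the bilinear form on $\mathbb Z[I]$ with $\phi(i,j)=d_ia_{ij}$ if $j<i$, $\phi(i,i)=d_i$, and $\phi(i,j)=-2p(i)p(j)$ if $j>i$. Fix a transversal $C\subset X$ for $X/\mathbb Z[I]$, where $\mathbb Z[I]\hookrightarrow X$ by $i\mapsto i'$,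 and put $\dot\phi(i,\mu'+c)=\phi(i,\mu)$ for $\mu\in\mathbb Z[I]$, $c\in C$. **Statement.** For all such data there is an automorphism $\dot\Psi$ of the $\mathbb Q(\mathbf t)$-algebra $\dot{\mathbf U}[\mathbf t]$ with $$\dot\Psi(1_\lambda)=1_\lambda,\quad \dot\Psi(E_i1_\lambda)=\mathbf t^{d_i\langle i,\lambda\rangle-\dot\phi(i,\lambda)}E_i1_\lambda,\quad \dot\Psi(F_i1_\lambda)=\mathbf t^{\dot\phi(i,\lambda)}F_i1_\lambda,\quad \dot\Psi(\pi x)=-\pi\,\dot\Psi(x),\quad \dot\Psi(vx)=\mathbf t^{-1}v\,\dot\Psi(x)$$ for all $i\in I$, $\lambda\in X$, $x\in\dot{\mathbf U}[\mathbf t]$, and the BGG categories $\mathcal O^{\mathbf t}_{\pi=1}$ over the quantum group $\mathbf U[\mathbf t]|_{\pi=1}$ and $\mathcal O^{\mathbf t}_{\pi=-1}$ over the quantum supergroup $\mathbf U[\mathbf t]|_{\pi=-1}$ are equivalent via $\dot\Psi$. That is, the action of $\dot{\mathbf U}[\mathbf t]$ described above exists on every object of either category, and there are an equivalence of categories $\mathcal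 F:\mathcal O^{\mathbf t}_{\pi=1}\to\mathcal O^{\mathbf t}_{\pi=-1}$ and additive bijections $\tau_M:M\to\mathcal F(M)$, natural in $M$, with $\tau_M(um)=\dot\Psi(u)\,\tau_M(m)$ for all $u\in\dot{\mathbf U}[\mathbf t]$ and $m\in M$. -/

import Mathlib

open scoped TensorProduct Polynomial
open CategoryTheory

universe w

noncomputable section

namespace CoveringQG

/-! ### Super Cartan data and super root data -/

/-- A bar-consistent super Cartan datum of anisotropic type on the set `I`.
The symmetric bilinear form on `ℤ[I]` is given by its values `dot i j` on the basis `I`. -/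
structure SuperCartanDatum (I : Type*) where
  dot : I → I → ℤ
  dot_symm : ∀ i j, dot i j = dot j i
  dot_self_even : ∀ i, 2 ∣ dot i i
  dot_self_pos : ∀ i, 0 < dot i i
  dot_dvd : ∀ i j, dot i i ∣ 2 * dot i j
  dot_nonpos : ∀ i j, i ≠ j → dot i j ≤ 0
  /-- The parity `p(i)`, that is `0` on the even and `1` on the odd part of `I`. -/
  parity : I → Fin 2
  odd_even : ∀ i j, parity i = 1 → 2 ∣ 2 * dot i j / dot i i
  bar_consistent : ∀ i, dot i i / 2 ≡ ((parity i : ℕ) : ℤ) [ZMOD 2]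

namespace SuperCartanDatum

variable {I : Type*} (D : SuperCartanDatum I)

/-- `d_i = (i · i) / 2`, a positive integer. -/
def d (i : I) : ℕ := (D.dot i i / 2).toNat

/-- `a_{ij} = 2 (i · j) / (i · i)`, an integer. -/
def a (i j : I) : ℤ := 2 * D.dot i j / D.dot i i

/-- `b_{ij} = 1 - a_{ij}`, used for `i ≠ j` only, where it is a positive integer. -/
def b (i j : I) : ℕ := (1 - D.a i j).toNat

/-- The parity as a natural number, `0` or `1`. -/
def p (i : I) : ℕ := (D.parity i : ℕ)

/-- The bilinear form `φ` on `ℤ[I]`, on basis elements, for a total order on `I`. -/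
def phi [LinearOrder I] (i j : I) : ℤ :=
  if j < i then D.d i * D.a i j
  else if j = i then D.d i
  else -2 * D.p i * D.p j

end SuperCartanDatum

/-- A super root datum (both `X`-regular and `Y`-regular): `Y` and `X` are the coweight and
weight lattices, `coroot i` is the element `i` of `Y` and `root i` is the element `i'` of `X`. -/
structure SuperRootDatum (I Y X : Type*) [AddCommGroup Y] [AddCommGroup X]
    extends SuperCartanDatum I where
  pairing : Y →ₗ[ℤ] X →ₗ[ℤ] ℤ
  perfect : pairing.IsPerfPair
  coroot : I → Y
  root : I → X
  coroot_indep : LinearIndependent ℤ coroot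
  root_indep : LinearIndependent ℤ root
  pairing_coroot_root : ∀ i j, pairing (coroot i) (root j) = 2 * dot i j / dot i i

/-! ### Scalars -/

/-- `R^π = R[π] / (π² - 1)`. -/
abbrev AdjPi (R : Type*) [CommRing R] : Type _ := AdjoinRoot (Polynomial.X ^ 2 - 1 : R[X])

/-- `R[𝐭]` with `𝐭² = -1`. -/
abbrev AdjT (R : Type*) [CommRing R] : Type _ := AdjoinRoot (Polynomial.X ^ 2 + 1 : R[X])

/-- `ℚ(v)`. -/
abbrev Qv : Type := RatFunc ℚ

/-- `ℚ(v,𝐭)`. -/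
abbrev Qvt : Type := AdjT Qv

/-- `ℚ(v)^π`. -/
abbrev QvPi : Type := AdjPi Qv

/-- `ℚ(v,𝐭)^π`. -/
abbrev QvtPi : Type := AdjPi Qvt

theorem root_pi_sq (R : Type*) [CommRing R] :
    AdjoinRoot.root (Polynomial.X ^ 2 - 1 : R[X]) ^ 2 = 1 := by
  have h := AdjoinRoot.eval₂_root (Polynomial.X ^ 2 - 1 : R[X])
  simpa [sub_eq_zero] using h

theorem root_t_sq (R : Type*) [CommRing R] :
    AdjoinRoot.root (Polynomial.X ^ 2 + 1 : R[X]) ^ 2 = -1 := by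
  have h := AdjoinRoot.eval₂_root (Polynomial.X ^ 2 + 1 : R[X])
  simpa [add_eq_zero_iff_eq_neg] using h

/-- `π` as a unit of `R^π`. -/
def piU (R : Type*) [CommRing R] : (AdjPi R)ˣ where
  val := AdjoinRoot.root _
  inv := AdjoinRoot.root _
  val_inv := by rw [← pow_two, root_pi_sq]
  inv_val := by rw [← pow_two, root_pi_sq]

/-- `𝐭` as a unit of `R[𝐭]`. -/
def tU (R : Type*) [CommRing R] : (AdjT R)ˣ where
  val := AdjoinRoot.root _
  inv := -AdjoinRoot.root _
  val_inv := by rw [mul_neg, ← pow_two, root_t_sq, neg_neg]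
  inv_val := by rw [neg_mul, ← pow_two, root_t_sq, neg_neg]

/-- `v` as a unit of `ℚ(v)`. -/
def vQv : Qvˣ := Units.mk0 RatFunc.X RatFunc.X_ne_zero

/-- `v` as a unit of `ℚ(v,𝐭)`. -/
def vQvt : Qvtˣ := Units.map (algebraMap Qv Qvt).toMonoidHom vQv

/-- `v` as a unit of `ℚ(v)^π`. -/
def vQvPi : QvPiˣ := Units.map (algebraMap Qv QvPi).toMonoidHom vQv

/-- `v` as a unit of `ℚ(v,𝐭)^π`. -/
def vQvtPi : QvtPiˣ := Units.map (algebraMap Qvt QvtPi).toMonoidHom vQvt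

/-- `𝐭` as a unit of `ℚ(v,𝐭)^π`. -/
def tQvtPi : QvtPiˣ := Units.map (algebraMap Qvt QvtPi).toMonoidHom (tU Qv)

/-- The inclusion `ℚ(v)^π → ℚ(v,𝐭)^π`, which sends `π` to `π`. -/
instance : Algebra QvPi QvtPi :=
  (AdjoinRoot.lift ((algebraMap Qvt QvtPi).comp (algebraMap Qv Qvt))
    (AdjoinRoot.root (Polynomial.X ^ 2 - 1 : Qvt[X]))
    (by simp [root_pi_sq])).toAlgebra

/-- The `ℚ(v,𝐭)^π`-algebra `ℚ(v,𝐭)_±`: it is `ℚ(v,𝐭)`, on which `π` acts as `ε = ±1`. -/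
def AtPi (_ε : ℤˣ) : Type := Qvt

instance (ε : ℤˣ) : CommRing (AtPi ε) := inferInstanceAs (CommRing Qvt)

instance (ε : ℤˣ) : Algebra QvtPi (AtPi ε) :=
  (AdjoinRoot.lift (RingHom.id Qvt) (((ε : ℤˣ) : ℤ) : Qvt)
    (by
      have h : (((ε : ℤˣ) : ℤ) : Qvt) ^ 2 = 1 := by
        rw [← Int.cast_pow, ← Units.val_pow_eq_pow_val, Int.units_sq]; simp
      simp [h]) : QvtPi →+* Qvt).toAlgebra

/-- `v` as a unit of `ℚ(v,𝐭)_±`. -/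
def vAt (ε : ℤˣ) : (AtPi ε)ˣ := vQvt

/-- The `(q,π)`-integer `[n] = ((π q)ⁿ - q⁻ⁿ) / (π q - q⁻¹)`. -/
def qint {R : Type*} [CommRing R] (q π : Rˣ) (n : ℤ) : R :=
  (((π * q) ^ n : Rˣ) - (q ^ (-n) : Rˣ) : R) * Ring.inverse ((π * q : Rˣ) - (q⁻¹ : Rˣ) : R)

/-- The `(q,π)`-binomial coefficient
`∏_{l=n-k+1}^{n} ((π q)^l - q^{-l}) / ∏_{l=1}^{k} ((π q)^l - q^{-l})`. -/
def qbinom {R : Type*} [CommRing R] (q π : Rˣ) (n : ℤ) (k : ℕ) : R :=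
  (∏ l ∈ Finset.Icc (n - k + 1) n, (((π * q) ^ l : Rˣ) - (q ^ (-l) : Rˣ) : R)) *
    Ring.inverse (∏ l ∈ Finset.Icc (1 : ℤ) k, (((π * q) ^ l : Rˣ) - (q ^ (-l) : Rˣ) : R))

variable {I Y X : Type*} [AddCommGroup Y] [AddCommGroup X]

/-- `v_i = v^{d_i}` in `ℚ(v)^π`. -/
def vi (D : SuperCartanDatum I) (i : I) : QvPiˣ := vQvPi ^ D.d i

/-- `π_i = π^{d_i}` in `ℚ(v)^π`. -/
def pii (D : SuperCartanDatum I) (i : I) : QvPiˣ := piU Qv ^ D.d i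

/-- The coefficient of the `k`-th term of the Serre relation for `i` and `j`. -/
def serreCoeff (D : SuperCartanDatum I) (i j : I) (k : ℕ) : QvPi :=
  (-1) ^ k * (piU Qv : QvPi) ^ (k.choose 2 * D.p i + k * D.p i * D.p j) *
    qbinom (vi D i) (pii D i) (D.b i j) k

/-! ### The covering quantum group -/

/-- The generators of the covering quantum group. -/
inductive Gen (I Y : Type*)
  | E (i : I)
  | F (i : I)
  | K (μ : Y)
  | J (μ : Y)

/-- A generator in the free algebra. -/
abbrev gen (x : Gen I Y) : FreeAlgebra QvPi (Gen I Y) := FreeAlgebra.ι QvPi x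

open Gen in
/-- The defining relations of the covering quantum group. -/
inductive Rel (D : SuperRootDatum I Y X) :
    FreeAlgebra QvPi (Gen I Y) → FreeAlgebra QvPi (Gen I Y) → Prop
  | J_add (μ ν : Y) : Rel D (gen (J μ) * gen (J ν)) (gen (J (μ + ν)))
  | K_add (μ ν : Y) : Rel D (gen (K μ) * gen (K ν)) (gen (K (μ + ν)))
  | K_zero : Rel D (gen (K 0)) 1
  | J_zero : Rel D (gen (J 0)) 1
  | J_sq (ν : Y) : Rel D (gen (J ν) ^ 2) 1
  | J_K (μ ν : Y) : Rel D (gen (J μ) * gen (K ν)) (gen (K ν) * gen (J μ))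
  | J_E (μ : Y) (i : I) : Rel D (gen (J μ) * gen (E i))
      (((piU Qv ^ D.pairing μ (D.root i) : QvPiˣ) : QvPi) • (gen (E i) * gen (J μ)))
  | J_F (μ : Y) (i : I) : Rel D (gen (J μ) * gen (F i))
      (((piU Qv ^ (-D.pairing μ (D.root i)) : QvPiˣ) : QvPi) • (gen (F i) * gen (J μ)))
  | K_E (μ : Y) (i : I) : Rel D (gen (K μ) * gen (E i))
      (((vQvPi ^ D.pairing μ (D.root i) : QvPiˣ) : QvPi) • (gen (E i) * gen (K μ)))
  | K_F (μ : Y) (i : I) : Rel D (gen (K μ) * gen (F i))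
      (((vQvPi ^ (-D.pairing μ (D.root i)) : QvPiˣ) : QvPi) • (gen (F i) * gen (K μ)))
  | E_F_same (i : I) : Rel D
      (gen (E i) * gen (F i) -
        (piU Qv : QvPi) ^ (D.p i * D.p i) • (gen (F i) * gen (E i)))
      (Ring.inverse (((pii D.toSuperCartanDatum i * vi D.toSuperCartanDatum i : QvPiˣ) : QvPi) -
          (((vi D.toSuperCartanDatum i)⁻¹ : QvPiˣ) : QvPi)) •
        (gen (J (D.d i • D.coroot i)) * gen (K (D.d i • D.coroot i)) -
          gen (K (-(D.d i • D.coroot i)))))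
  | E_F_ne (i j : I) (h : i ≠ j) : Rel D
      (gen (E i) * gen (F j) -
        (piU Qv : QvPi) ^ (D.p i * D.p j) • (gen (F j) * gen (E i))) 0
  | serre_E (i j : I) (h : i ≠ j) : Rel D
      (∑ k ∈ Finset.range (D.b i j + 1), serreCoeff D.toSuperCartanDatum i j k •
        (gen (E i) ^ (D.b i j - k) * gen (E j) * gen (E i) ^ k)) 0
  | serre_F (i j : I) (h : i ≠ j) : Rel D
      (∑ k ∈ Finset.range (D.b i j + 1), serreCoeff D.toSuperCartanDatum i j k •
        (gen (F i) ^ (D.b i j - k) * gen (F j) * gen (F i) ^ k)) 0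

/-- The covering quantum group `𝐔`, a `ℚ(v)^π`-algebra. -/
abbrev U (D : SuperRootDatum I Y X) := RingQuot (Rel D)

/-- `𝐔[𝐭] = ℚ(v,𝐭)^π ⊗ 𝐔`. -/
abbrev Ut (D : SuperRootDatum I Y X) := QvtPi ⊗[QvPi] U D

/-- The specialization of `𝐔[𝐭]` at `π = ε`, where `ε = ±1`: the quantum group for `ε = 1` and the
quantum supergroup for `ε = -1`. It is an algebra over `ℚ(v,𝐭)`. -/
abbrev UAt (D : SuperRootDatum I Y X) (ε : ℤˣ) := AtPi ε ⊗[QvtPi] Ut D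

/-- The image of a generator in the specialization of `𝐔[𝐭]` at `π = ε`. -/
def UAt.of (D : SuperRootDatum I Y X) (ε : ℤˣ) (x : Gen I Y) : UAt D ε :=
  (1 : AtPi ε) ⊗ₜ[QvtPi] ((1 : QvtPi) ⊗ₜ[QvPi] RingQuot.mkAlgHom QvPi (Rel D) (gen x))

/-! ### The modified covering quantum group -/

/-- The generators `1_λ`, `E_i 1_λ`, `F_i 1_λ` of the modified covering quantum group. -/
inductive DotGen (I X : Type*)
  | one (l : X)
  | E (i : I) (l : X)
  | F (i : I) (l : X)

/-- A generator in the free algebra. -/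
abbrev dgen (x : DotGen I X) : FreeAlgebra QvPi (DotGen I X) := FreeAlgebra.ι QvPi x

/-- `E_i^n 1_λ`. -/
def dotEpow (D : SuperRootDatum I Y X) (i : I) : ℕ → X → FreeAlgebra QvPi (DotGen I X)
  | 0, l => dgen (.one l)
  | n + 1, l => dgen (.E i (l + n • D.root i)) * dotEpow D i n l

/-- `F_i^n 1_λ`. -/
def dotFpow (D : SuperRootDatum I Y X) (i : I) : ℕ → X → FreeAlgebra QvPi (DotGen I X)
  | 0, l => dgen (.one l)
  | n + 1, l => dgen (.F i (l - n • D.root i)) * dotFpow D i n l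

/-- The defining relations of the modified covering quantum group. -/
inductive DotRel (D : SuperRootDatum I Y X) :
    FreeAlgebra QvPi (DotGen I X) → FreeAlgebra QvPi (DotGen I X) → Prop
  | one_one (l : X) : DotRel D (dgen (.one l) * dgen (.one l)) (dgen (.one l))
  | one_one_ne (l m : X) (h : l ≠ m) : DotRel D (dgen (.one l) * dgen (.one m)) 0
  | E_one (i : I) (l : X) : DotRel D (dgen (.E i l) * dgen (.one l)) (dgen (.E i l))
  | E_one_ne (i : I) (l m : X) (h : l ≠ m) : DotRel D (dgen (.E i l) * dgen (.one m)) 0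
  | one_E (i : I) (l : X) :
      DotRel D (dgen (.one (l + D.root i)) * dgen (.E i l)) (dgen (.E i l))
  | one_E_ne (i : I) (l m : X) (h : m ≠ l + D.root i) :
      DotRel D (dgen (.one m) * dgen (.E i l)) 0
  | F_one (i : I) (l : X) : DotRel D (dgen (.F i l) * dgen (.one l)) (dgen (.F i l))
  | F_one_ne (i : I) (l m : X) (h : l ≠ m) : DotRel D (dgen (.F i l) * dgen (.one m)) 0
  | one_F (i : I) (l : X) :
      DotRel D (dgen (.one (l - D.root i)) * dgen (.F i l)) (dgen (.F i l))
  | one_F_ne (i : I) (l m : X) (h : m ≠ l - D.root i) :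
      DotRel D (dgen (.one m) * dgen (.F i l)) 0
  | E_F_same (i : I) (l : X) : DotRel D
      (dgen (.E i (l - D.root i)) * dgen (.F i l) -
        (piU Qv : QvPi) ^ (D.p i * D.p i) • (dgen (.F i (l + D.root i)) * dgen (.E i l)))
      (qint (vi D.toSuperCartanDatum i) (pii D.toSuperCartanDatum i)
        (D.pairing (D.coroot i) l) • dgen (.one l))
  | E_F_ne (i j : I) (l : X) (h : i ≠ j) : DotRel D
      (dgen (.E i (l - D.root j)) * dgen (.F j l) -
        (piU Qv : QvPi) ^ (D.p i * D.p j) • (dgen (.F j (l + D.root i)) * dgen (.E i l))) 0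
  | serre_E (i j : I) (l : X) (h : i ≠ j) : DotRel D
      (∑ k ∈ Finset.range (D.b i j + 1), serreCoeff D.toSuperCartanDatum i j k •
        (dotEpow D i (D.b i j - k) (l + k • D.root i + D.root j) *
          dgen (.E j (l + k • D.root i)) * dotEpow D i k l)) 0
  | serre_F (i j : I) (l : X) (h : i ≠ j) : DotRel D
      (∑ k ∈ Finset.range (D.b i j + 1), serreCoeff D.toSuperCartanDatum i j k •
        (dotFpow D i (D.b i j - k) (l - k • D.root i - D.root j) *
          dgen (.F j (l - k • D.root i)) * dotFpow D i k l)) 0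

/-- A generator in the unital algebra presented by the generators and relations of the modified
covering quantum group. -/
def dotMk (D : SuperRootDatum I Y X) (x : DotGen I X) : RingQuot (DotRel D) :=
  RingQuot.mkAlgHom QvPi (DotRel D) (dgen x)

/-- The modified covering quantum group `𝐔̇`, an algebra without unit over `ℚ(v)^π`.
The *unital* algebra with a given presentation (none of whose relations involves the unit) is the
unitization of the *non-unital* algebra with the same presentation, and the latter is its
non-unital subalgebra generated by the generators. -/
def UdotSubalgebra (D : SuperRootDatum I Y X) : NonUnitalSubalgebra QvPi (RingQuot (DotRel D)) :=
  NonUnitalAlgebra.adjoin QvPi (Set.range (dotMk D))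

/-- The modified covering quantum group `𝐔̇`, as a type. -/
abbrev Udot (D : SuperRootDatum I Y X) := UdotSubalgebra D

/-- A generator of the modified covering quantum group. -/
def Udot.of (D : SuperRootDatum I Y X) (x : DotGen I X) : Udot D :=
  ⟨dotMk D x, NonUnitalAlgebra.subset_adjoin QvPi ⟨x, rfl⟩⟩

/-- `𝐔̇[𝐭] = ℚ(v,𝐭)^π ⊗ 𝐔̇`. -/
abbrev Udott (D : SuperRootDatum I Y X) := QvtPi ⊗[QvPi] Udot D

/-- A generator of `𝐔̇[𝐭]`. -/
def Udott.of (D : SuperRootDatum I Y X) (x : DotGen I X) : Udott D :=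
  (1 : QvtPi) ⊗ₜ[QvPi] Udot.of D x

/-! ### The twistor -/

/-- A transversal for `X / ℤ[I]`: each weight is uniquely of the form `μ' + c` with `μ ∈ ℤ[I]`
and `c` in the transversal. -/
structure Transversal [Fintype I] (D : SuperRootDatum I Y X) where
  carrier : Set X
  existsUnique_rep : ∀ l : X, ∃! x : (I → ℤ) × carrier, (∑ j, x.1 j • D.root j) + x.2 = l

/-- The number `φ̇(i, λ) = φ(i, μ)`, where `λ = μ' + c` with `μ ∈ ℤ[I]` and `c ∈ C`. -/
def dotphi [Fintype I] [LinearOrder I] (D : SuperRootDatum I Y X) (C : Transversal D)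
    (i : I) (l : X) : ℤ :=
  ∑ j, (C.existsUnique_rep l).choose.1 j * D.phi i j

/-- `Ψ` is the twistor `Ψ̇`, the automorphism of the ring (without unit) `𝐔̇[𝐭]` that is
`ℚ(𝐭)`-linear, sends `π` to `-π` and `v` to `𝐭⁻¹ v`, and is given on generators as follows.
(Additive maps are `ℚ`-linear.) -/
structure IsTwistor [Fintype I] [LinearOrder I] (D : SuperRootDatum I Y X) (C : Transversal D)
    (Ψ : Udott D ≃+* Udott D) : Prop where
  map_one : ∀ l, Ψ (Udott.of D (.one l)) = Udott.of D (.one l)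
  map_E : ∀ i l, Ψ (Udott.of D (.E i l)) =
    ((tQvtPi ^ (D.d i * D.pairing (D.coroot i) l - dotphi D C i l) : QvtPiˣ) : QvtPi) •
      Udott.of D (.E i l)
  map_F : ∀ i l, Ψ (Udott.of D (.F i l)) =
    ((tQvtPi ^ dotphi D C i l : QvtPiˣ) : QvtPi) • Udott.of D (.F i l)
  map_t_smul : ∀ x, Ψ ((tQvtPi : QvtPi) • x) = (tQvtPi : QvtPi) • Ψ x
  map_pi_smul : ∀ x, Ψ ((piU Qvt : QvtPi) • x) = (-(piU Qvt : QvtPi)) • Ψ x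
  map_v_smul : ∀ x, Ψ ((vQvtPi : QvtPi) • x) = ((tQvtPi⁻¹ * vQvtPi : QvtPiˣ) : QvtPi) • Ψ x

/-! ### Weight modules and category `𝓞` -/

/-- A module over the specialization of `𝐔[𝐭]` at `π = ε` is a vector space over `ℚ(v,𝐭)`. -/
instance {D : SuperRootDatum I Y X} {ε : ℤˣ} (M : ModuleCat (UAt D ε)) : Module (AtPi ε) M :=
  Module.restrictScalars (AtPi ε) (UAt D ε) M

instance {D : SuperRootDatum I Y X} {ε : ℤˣ} (M : ModuleCat (UAt D ε)) :
    IsScalarTower (AtPi ε) (UAt D ε) M :=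
  IsScalarTower.restrictScalars (AtPi ε) (UAt D ε) M

/-- The weight space `M_λ = {m | K_ν m = v^⟨ν,λ⟩ m, J_ν m = π^⟨ν,λ⟩ m for all ν ∈ Y}` of a module
over the specialization at `π = ε`. -/
def weightSpace {D : SuperRootDatum I Y X} {ε : ℤˣ} (M : ModuleCat (UAt D ε)) (l : X) :
    Submodule (AtPi ε) M where
  carrier := {m | ∀ ν : Y,
    UAt.of D ε (.K ν) • m = ((vAt ε ^ D.pairing ν l : (AtPi ε)ˣ) : AtPi ε) • m ∧
    UAt.of D ε (.J ν) • m = ((ε ^ D.pairing ν l : ℤˣ) : ℤ) • m}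
  zero_mem' := fun ν => by simp
  add_mem' := fun {x y} hx hy ν => by
    simp only [smul_add, (hx ν).1, (hy ν).1, (hx ν).2, (hy ν).2, and_self]
  smul_mem' := fun c x hx ν => by
    have h : ∀ u : UAt D ε, u • c • x = c • u • x := fun u => by
      rw [← algebraMap_smul (UAt D ε) c x, ← algebraMap_smul (UAt D ε) c (u • x), ← mul_smul,
        ← mul_smul, Algebra.commutes]
    refine ⟨?_, ?_⟩
    · rw [h, (hx ν).1, smul_comm]
    · rw [h, (hx ν).2, smul_comm]

/-- A weight module is the direct sum of its weight spaces. -/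
def IsWeightModule {D : SuperRootDatum I Y X} {ε : ℤˣ} (M : ModuleCat (UAt D ε)) : Prop :=
  iSupIndep (weightSpace M) ∧ ⨆ l, weightSpace M l = ⊤

/-- Membership in the BGG category `𝓞`: a weight module with finite-dimensional weight spaces
whose weights lie in a finite union of cones `λ - ∑ i, ℕ i'`. -/
def IsCatO [Fintype I] (D : SuperRootDatum I Y X) (ε : ℤˣ) :
    ObjectProperty (ModuleCat (UAt D ε)) := fun M =>
  IsWeightModule M ∧
  (∀ l, Module.Finite (AtPi ε) (weightSpace M l)) ∧
  ∃ S : Finset X, ∀ m, weightSpace M m ≠ ⊥ →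
    ∃ l ∈ S, ∃ n : I → ℕ, m = l - ∑ i, n i • D.root i

/-- The BGG category `𝓞` for the specialization of `𝐔[𝐭]` at `π = ε`, a full subcategory of the
category of all modules. -/
abbrev CatO [Fintype I] (D : SuperRootDatum I Y X) (ε : ℤˣ) :=
  ObjectProperty.FullSubcategory (C := ModuleCat.{w} (UAt D ε)) (IsCatO D ε)

/-- The action of `𝐔̇[𝐭]` on a weight module `M` over the specialization of `𝐔[𝐭]` at `π = ε` that
makes `M` a unital module: scalars act through `π ↦ ε`, the idempotent `1_λ` acts as the projection
to `M_λ`, and `E_i 1_λ`, `F_i 1_λ` act on `M_λ` as `E_i`, `F_i`.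
There is at most one such action if `M` is a weight module. -/
structure DotAction {D : SuperRootDatum I Y X} {ε : ℤˣ} (M : ModuleCat (UAt D ε)) where
  act : Udott D →ₙ+* Module.End (AtPi ε) M
  act_smul : ∀ (c : QvtPi) (u : Udott D), act (c • u) = algebraMap QvtPi (AtPi ε) c • act u
  act_one : ∀ l, ∀ m ∈ weightSpace M l, act (Udott.of D (.one l)) m = m
  act_one_ne : ∀ l l', l ≠ l' → ∀ m ∈ weightSpace M l', act (Udott.of D (.one l)) m = 0
  act_E : ∀ i l, ∀ m ∈ weightSpace M l, act (Udott.of D (.E i l)) m = UAt.of D ε (.E i) • m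
  act_F : ∀ i l, ∀ m ∈ weightSpace M l, act (Udott.of D (.F i l)) m = UAt.of D ε (.F i) • m

end CoveringQG

end

noncomputable section

namespace CoveringQG

/-! ### The field `ℚ(v,𝐭)` and its automorphism `v ↦ 𝐭⁻¹ v` -/

/-! The twistor exists because the structure constants of the presentation only acquire powers of 𝐭.
Under π ↦ -π, v ↦ 𝐭⁻¹v both πᵢvᵢ and vᵢ⁻¹ are multiplied by 𝐭^{dᵢ}, so a (q,π)-integer or binomial
is multiplied by a power of 𝐭 (`map_qint`, `map_qbinom`). Rescaling the generators by powers of 𝐭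
has to absorb these factors. Two conditions on the exponents suffice (`TwistExponents`): those of
Eᵢ1_λ and Fᵢ1_λ add up to dᵢ⟨i,λ⟩, and the second one changes by φ(i,j) along j'. As 𝐭⁴ = 1, every
relation becomes a congruence modulo 4. The arithmetic inputs are dᵢ ≡ p(i) mod 2 and, for i ≠ j,
φ(i,j) - φ(j,i) ≡ i·j + 2p(i)p(j) mod 4 (`SuperCartanDatum.exists_phi_sub`). The verification is
`TwistExponents.dotSat`. The universal property `exists_dotLift` turns it into an endomorphism of
𝐔̇[𝐭], which is invertible because its fourth power is the identity.

For the categories, a weight module over 𝐔[𝐭] at π = ε is the same thing as a module over 𝐔̇[𝐭] on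
which π acts as ε and the 1_λ are the projections of a direct sum decomposition. Both amount to
operators that shift weight spaces and satisfy the relations there (`WeightRep`); K_μ and J_μ are
recovered as scalars on each weight space. Pulling the action back along the inverse twistor keeps
the projections 1_λ, exchanges the two signs of π, and changes the vector space structure by an
automorphism of ℚ(v,𝐭). The K_ν alone separate weights (`mem_of_ofDotEquiv_mem`), so the new weight
spaces are the old ones and the conditions defining 𝓞 carry over.

Morphisms on either side are exactly the additive maps commuting with 𝐔̇[𝐭] (`DotAction.hom_act`,
`DotAction.map_smul_of_act`). Hence twisting is a functor, and twisting by the inverse automorphism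
is a quasi-inverse. -/

/-- A square root of -1 would be integral over ℚ[v], hence a polynomial, and its value at 0 would be
a rational number with square -1. -/
theorem Qv_sq_ne_neg_one (x : Qv) : x ^ 2 ≠ -1 := by
  intro hx
  have hint : IsIntegral ℚ[X] x :=
    ⟨Polynomial.X ^ 2 + 1, by monicity!, by simp [hx]⟩
  obtain ⟨p, rfl⟩ := IsIntegrallyClosed.isIntegral_iff.1 hint
  have hp : p ^ 2 = -1 := by
    apply IsFractionRing.injective ℚ[X] Qv
    simpa using hx
  have h0 := congrArg (Polynomial.eval 0) hp
  simp only [Polynomial.eval_pow, Polynomial.eval_neg, Polynomial.eval_one] at h0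
  nlinarith [sq_nonneg (Polynomial.eval 0 p)]

theorem irreducible_X_sq_add_one : Irreducible (Polynomial.X ^ 2 + 1 : Qv[X]) := by
  have hdeg : (Polynomial.X ^ 2 + 1 : Qv[X]).natDegree = 2 := by compute_degree!
  rw [Polynomial.irreducible_iff_roots_eq_zero_of_degree_le_three (by omega) (by omega)]
  refine Multiset.eq_zero_of_forall_notMem fun x hx => Qv_sq_ne_neg_one x ?_
  have h := (Polynomial.mem_roots'.1 hx).2
  simp only [Polynomial.IsRoot.def, Polynomial.eval_add, Polynomial.eval_pow, Polynomial.eval_X,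
    Polynomial.eval_one] at h
  exact eq_neg_of_add_eq_zero_left h

theorem Qvt_isUnit {x : Qvt} (h : x ≠ 0) : IsUnit x := by
  have : Fact (Irreducible (Polynomial.X ^ 2 + 1 : Qv[X])) := ⟨irreducible_X_sq_add_one⟩
  exact isUnit_iff_ne_zero.2 h

/-- Since 𝐭 is algebraic over ℚ, algebraicity of 𝐭⁻¹v would make v = 𝐭 · 𝐭⁻¹v algebraic. So 𝐭⁻¹v is
transcendental, which is what extending v ↦ 𝐭⁻¹v from polynomials to ℚ(v) requires. -/
theorem Qvt_eval_isUnit {p : ℚ[X]} (hp : p ≠ 0) :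
    IsUnit (Polynomial.eval₂RingHom (algebraMap ℚ Qvt) (((tU Qv)⁻¹ * vQvt : Qvtˣ) : Qvt) p) := by
  have : Fact (Irreducible (Polynomial.X ^ 2 + 1 : Qv[X])) := ⟨irreducible_X_sq_add_one⟩
  apply Qvt_isUnit
  intro h0
  have halg : IsAlgebraic ℚ (((tU Qv)⁻¹ * vQvt : Qvtˣ) : Qvt) := ⟨p, hp, h0⟩
  have ht : IsAlgebraic ℚ ((tU Qv : Qvtˣ) : Qvt) :=
    ⟨Polynomial.X ^ 2 + 1, Polynomial.Monic.ne_zero (by monicity!), by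
      simp [tU, root_t_sq]⟩
  have hv : IsAlgebraic ℚ ((vQvt : Qvtˣ) : Qvt) := by
    have := ht.mul halg
    rwa [← Units.val_mul, mul_inv_cancel_left] at this
  have hv' : IsAlgebraic ℚ (algebraMap Qv Qvt RatFunc.X) := hv
  obtain ⟨q, hq, hq0⟩ := hv'
  refine (RatFunc.transcendental_X (K := ℚ)) ⟨q, hq, ?_⟩
  apply (algebraMap Qv Qvt).injective
  refine (Polynomial.hom_eval₂ q _ (algebraMap Qv Qvt) RatFunc.X).trans ?_
  rw [map_zero, ← hq0, Polynomial.aeval_def]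
  congr 1
  exact RingHom.ext_rat _ _

/-- The embedding `ℚ(v) → ℚ(v,𝐭)` that sends `v` to `𝐭⁻¹ v`. -/
def twistQv : Qv →+* Qvt :=
  IsLocalization.lift (M := nonZeroDivisors ℚ[X])
    (g := Polynomial.eval₂RingHom (algebraMap ℚ Qvt) (((tU Qv)⁻¹ * vQvt : Qvtˣ) : Qvt))
    fun y => Qvt_eval_isUnit (nonZeroDivisors.coe_ne_zero y)

theorem twistQv_X : twistQv RatFunc.X = (((tU Qv)⁻¹ * vQvt : Qvtˣ) : Qvt) := by
  rw [← RatFunc.algebraMap_X, twistQv, IsLocalization.lift_eq]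
  simp

/-- The endomorphism of `ℚ(v,𝐭)` that fixes `𝐭` and sends `v` to `𝐭⁻¹ v`. -/
def twistQvt : Qvt →+* Qvt :=
  AdjoinRoot.lift twistQv (AdjoinRoot.root _) (by simp [root_t_sq])

theorem twistQvt_t : twistQvt (tU Qv : Qvtˣ) = (tU Qv : Qvtˣ) :=
  AdjoinRoot.lift_root _

theorem twistQvt_v : twistQvt (vQvt : Qvtˣ) = (((tU Qv)⁻¹ * vQvt : Qvtˣ) : Qvt) :=
  (AdjoinRoot.lift_of _).trans twistQv_X

theorem Qvt_hom_ext {R : Type*} [CommRing R] {f g : Qvt →+* R}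
    (ht : f (tU Qv : Qvtˣ) = g (tU Qv : Qvtˣ)) (hv : f (vQvt : Qvtˣ) = g (vQvt : Qvtˣ)) :
    f = g := by
  apply AdjoinRoot.ringHom_ext _ ht
  apply IsLocalization.ringHom_ext (nonZeroDivisors ℚ[X])
  apply Polynomial.ringHom_ext'
  · exact RingHom.ext_rat _ _
  · have hX : algebraMap ℚ[X] Qv Polynomial.X = RatFunc.X := RatFunc.algebraMap_X
    simp only [RingHom.comp_apply, hX]
    exact hv

theorem units_map_twistQvt_t : Units.map (twistQvt : Qvt →* Qvt) (tU Qv) = tU Qv :=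
  Units.ext twistQvt_t

theorem units_map_twistQvt_v : Units.map (twistQvt : Qvt →* Qvt) vQvt = (tU Qv)⁻¹ * vQvt :=
  Units.ext twistQvt_v

theorem tU_sq (R : Type*) [CommRing R] : (tU R) ^ 2 = -1 :=
  Units.ext (by simpa [tU] using root_t_sq R)

theorem tU_pow_four (R : Type*) [CommRing R] : (tU R) ^ 4 = 1 := by
  rw [show 4 = 2 * 2 from rfl, pow_mul, tU_sq]; simp

/-- Because 𝐭 is fixed, iterating gives v ↦ 𝐭⁻⁴v = v. The inverse is therefore the third iterate and
needs no construction of its own. -/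
theorem twistQvt_comp_four :
    twistQvt.comp (twistQvt.comp (twistQvt.comp twistQvt)) = RingHom.id Qvt := by
  apply Qvt_hom_ext
  · simp [twistQvt_t]
  · change ((Units.map (twistQvt : Qvt →* Qvt) (Units.map (twistQvt : Qvt →* Qvt)
      (Units.map (twistQvt : Qvt →* Qvt) (Units.map (twistQvt : Qvt →* Qvt) vQvt))) : Qvtˣ)
      : Qvt) = (vQvt : Qvtˣ)
    congr 1
    simp only [units_map_twistQvt_v, map_mul, map_inv, units_map_twistQvt_t]
    have h : (tU Qv)⁻¹ * ((tU Qv)⁻¹ * ((tU Qv)⁻¹ * ((tU Qv)⁻¹ * vQvt))) =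
      (tU Qv ^ 4)⁻¹ * vQvt := by group
    rw [h, tU_pow_four]; simp

/-- The automorphism of `ℚ(v,𝐭)` that fixes `𝐭` and sends `v` to `𝐭⁻¹ v`. -/
def twistQvtEquiv : Qvt ≃+* Qvt :=
  RingEquiv.ofRingHom twistQvt (twistQvt.comp (twistQvt.comp twistQvt))
    twistQvt_comp_four twistQvt_comp_four

/-! ### The automorphism `π ↦ -π`, `v ↦ 𝐭⁻¹ v` of `ℚ(v,𝐭)^π` -/

/-- The endomorphism of `ℚ(v,𝐭)^π` that fixes `𝐭` and sends `π` to `-π` and `v` to `𝐭⁻¹ v`. -/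
def twistQvtPi : QvtPi →+* QvtPi :=
  AdjoinRoot.lift ((algebraMap Qvt QvtPi).comp twistQvt) (-AdjoinRoot.root _)
    (by simp [root_pi_sq])

theorem twistQvtPi_algebraMap (x : Qvt) :
    twistQvtPi (algebraMap Qvt QvtPi x) = algebraMap Qvt QvtPi (twistQvt x) :=
  AdjoinRoot.lift_of _

theorem twistQvtPi_pi : twistQvtPi (piU Qvt : QvtPiˣ) = -(piU Qvt : QvtPiˣ) :=
  AdjoinRoot.lift_root _

theorem twistQvtPi_t : twistQvtPi (tQvtPi : QvtPiˣ) = (tQvtPi : QvtPiˣ) := by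
  change twistQvtPi (algebraMap Qvt QvtPi _) = algebraMap Qvt QvtPi _
  rw [twistQvtPi_algebraMap, twistQvt_t]

theorem twistQvtPi_v :
    twistQvtPi (vQvtPi : QvtPiˣ) = ((tQvtPi⁻¹ * vQvtPi : QvtPiˣ) : QvtPi) := by
  change twistQvtPi (algebraMap Qvt QvtPi _) = _
  rw [twistQvtPi_algebraMap, twistQvt_v, tQvtPi, vQvtPi, ← map_inv, ← map_mul]
  rfl

theorem tQvtPi_sq : tQvtPi ^ 2 = -1 := by
  rw [tQvtPi, ← map_pow, tU_sq]; exact Units.ext (by simp)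

theorem twistQvtPi_comp_four :
    twistQvtPi.comp (twistQvtPi.comp (twistQvtPi.comp twistQvtPi)) = RingHom.id QvtPi := by
  apply AdjoinRoot.ringHom_ext
  · refine RingHom.ext fun x => ?_
    change twistQvtPi (twistQvtPi (twistQvtPi (twistQvtPi (algebraMap Qvt QvtPi x)))) =
      algebraMap Qvt QvtPi x
    simp only [twistQvtPi_algebraMap]
    exact congrArg _ (RingHom.congr_fun twistQvt_comp_four x)
  · change twistQvtPi (twistQvtPi (twistQvtPi (twistQvtPi (piU Qvt : QvtPiˣ)))) =
      (piU Qvt : QvtPiˣ)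
    simp only [twistQvtPi_pi, map_neg, neg_neg]

/-! ### Specializations -/

theorem algebraMap_QvPi_pi : algebraMap QvPi QvtPi (piU Qv : QvPiˣ) = (piU Qvt : QvtPiˣ) :=
  AdjoinRoot.lift_root _

theorem algebraMap_QvPi_v : algebraMap QvPi QvtPi (vQvPi : QvPiˣ) = (vQvtPi : QvtPiˣ) :=
  AdjoinRoot.lift_of _

theorem algebraMap_AtPi_of (ε : ℤˣ) (x : Qvt) :
    algebraMap QvtPi (AtPi ε) (algebraMap Qvt QvtPi x) = (x : Qvt) :=
  AdjoinRoot.lift_of (i := RingHom.id Qvt) _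

theorem algebraMap_AtPi_pi (ε : ℤˣ) :
    algebraMap QvtPi (AtPi ε) (piU Qvt : QvtPiˣ) = ((ε : ℤ) : AtPi ε) :=
  AdjoinRoot.lift_root (i := RingHom.id Qvt) _

theorem algebraMap_AtPi_v (ε : ℤˣ) :
    algebraMap QvtPi (AtPi ε) (vQvtPi : QvtPiˣ) = (vAt ε : (AtPi ε)ˣ) :=
  algebraMap_AtPi_of ε _

theorem algebraMap_AtPi_surjective (ε : ℤˣ) :
    Function.Surjective (algebraMap QvtPi (AtPi ε)) :=
  fun x => ⟨algebraMap Qvt QvtPi x, algebraMap_AtPi_of ε x⟩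

/-- The automorphism `v ↦ 𝐭⁻¹ v`, between the specializations at `π = ε` and `π = ε'`. -/
def twistAt (ε ε' : ℤˣ) : AtPi ε ≃+* AtPi ε' := twistQvtEquiv

/-- Setting π = ε' after π ↦ -π amounts to setting π = -ε' = ε. This is where the quantum group and
the quantum supergroup change places. -/
theorem twistAt_algebraMap {ε ε' : ℤˣ} (h : ε' = -ε) (c : QvtPi) :
    algebraMap QvtPi (AtPi ε') (twistQvtPi c) = twistAt ε ε' (algebraMap QvtPi (AtPi ε) c) := by
  suffices H : (algebraMap QvtPi (AtPi ε')).comp twistQvtPi =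
      (twistAt ε ε' : AtPi ε →+* AtPi ε').comp (algebraMap QvtPi (AtPi ε)) from
    RingHom.congr_fun H c
  apply AdjoinRoot.ringHom_ext
  · refine RingHom.ext fun x => ?_
    change algebraMap QvtPi (AtPi ε') (twistQvtPi (algebraMap Qvt QvtPi x)) =
      twistAt ε ε' (algebraMap QvtPi (AtPi ε) (algebraMap Qvt QvtPi x))
    rw [twistQvtPi_algebraMap, algebraMap_AtPi_of, algebraMap_AtPi_of]
    rfl
  · change algebraMap QvtPi (AtPi ε') (twistQvtPi (piU Qvt : QvtPiˣ)) =
      twistAt ε ε' (algebraMap QvtPi (AtPi ε) (piU Qvt : QvtPiˣ))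
    rw [twistQvtPi_pi, map_neg, algebraMap_AtPi_pi, algebraMap_AtPi_pi, map_intCast, h]
    simp

/-- The homomorphism `ℚ(v)^π → ℚ(v,𝐭)` with `π ↦ ε`. -/
def specQvPi (ε : ℤˣ) : QvPi →+* AtPi ε :=
  (algebraMap QvtPi (AtPi ε)).comp (algebraMap QvPi QvtPi)

theorem specQvPi_pi (ε : ℤˣ) : specQvPi ε (piU Qv : QvPiˣ) = ((ε : ℤ) : AtPi ε) := by
  rw [specQvPi, RingHom.comp_apply, algebraMap_QvPi_pi, algebraMap_AtPi_pi]

theorem specQvPi_v (ε : ℤˣ) : specQvPi ε (vQvPi : QvPiˣ) = (vAt ε : (AtPi ε)ˣ) := by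
  rw [specQvPi, RingHom.comp_apply, algebraMap_QvPi_v, algebraMap_AtPi_v]

/-! ### Invertibility of differences of powers of `v` -/

theorem RatFunc_X_zpow_ne_one {n : ℤ} (hn : n ≠ 0) : (RatFunc.X : Qv) ^ n ≠ 1 := by
  have key : ∀ m : ℕ, m ≠ 0 → (RatFunc.X : Qv) ^ m ≠ 1 := by
    intro m hm h
    rw [← RatFunc.algebraMap_X, ← map_pow, ← map_one (algebraMap ℚ[X] Qv)] at h
    have h' := congrArg Polynomial.natDegree (IsFractionRing.injective ℚ[X] Qv h)
    simp at h'
    exact hm h'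
  obtain ⟨m, rfl | rfl⟩ := n.eq_nat_or_neg
  · simpa using key m (by simpa using hn)
  · simpa using key m (by simpa using hn)

/-- Needed to tell apart the eigenvalues of K_ν on different weight spaces. -/
theorem vAt_zpow_sub_isUnit (ε : ℤˣ) {a b : ℤ} (h : a ≠ b) :
    IsUnit (((vAt ε ^ a : (AtPi ε)ˣ) : AtPi ε) - ((vAt ε ^ b : (AtPi ε)ˣ) : AtPi ε)) := by
  have hQ : IsUnit (((vQv ^ a : Qvˣ) : Qv) - ((vQv ^ b : Qvˣ) : Qv)) := by
    rw [isUnit_iff_ne_zero, sub_ne_zero]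
    intro hab
    have hab' : vQv ^ (a - b) = 1 := by rw [zpow_sub, Units.ext hab, mul_inv_cancel]
    have := congrArg Units.val hab'
    rw [Units.val_zpow_eq_zpow_val] at this
    exact RatFunc_X_zpow_ne_one (sub_ne_zero.2 h) this
  have := hQ.map (algebraMap Qv Qvt)
  rw [map_sub] at this
  have e : ∀ n : ℤ, ((vAt ε ^ n : (AtPi ε)ˣ) : AtPi ε) =
      algebraMap Qv Qvt ((vQv ^ n : Qvˣ) : Qv) := by
    intro n
    change ((vQvt ^ n : Qvtˣ) : Qvt) = _
    rw [vQvt, ← map_zpow]; rfl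
  rw [e, e]; exact this

/-! ### `(q,π)`-integers and binomial coefficients under ring homomorphisms -/

section QInt

variable {R S : Type*} [CommRing R] [CommRing S]

theorem coe_units_map (φ : R →+* S) (u : Rˣ) :
    ((Units.map (φ : R →* S) u : Sˣ) : S) = φ u := rfl

theorem map_ringInverse (φ : R →+* S) {x : R} (h : IsUnit x) :
    φ (Ring.inverse x) = Ring.inverse (φ x) := by
  obtain ⟨u, rfl⟩ := h
  rw [Ring.inverse_unit, ← coe_units_map φ u, Ring.inverse_unit, ← map_inv, coe_units_map]

variable (φ ψ : R →+* S) (s : Sˣ) (q π : Rˣ)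

/-- Relative to ψ, the map φ multiplies both πq and q⁻¹ by s, so the two terms of the difference
scale by the same power. -/
theorem map_qfactor
    (hq : Units.map (φ : R →* S) q = s⁻¹ * Units.map (ψ : R →* S) q)
    (hπ : Units.map (φ : R →* S) π = s ^ 2 * Units.map (ψ : R →* S) π)
    (l : ℤ) :
    φ (((π * q) ^ l : Rˣ) - (q ^ (-l) : Rˣ) : R) =
      (s ^ l : Sˣ) * ψ (((π * q) ^ l : Rˣ) - (q ^ (-l) : Rˣ) : R) := by
  rw [map_sub, map_sub, ← coe_units_map, ← coe_units_map, ← coe_units_map, ← coe_units_map,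
    mul_sub, ← Units.val_mul, ← Units.val_mul]
  simp only [map_zpow, map_mul, hq, hπ]
  congr 2
  · rw [← mul_zpow]; congr 1
    rw [pow_two]; simp only [mul_assoc, mul_left_comm]
    rw [mul_left_comm _ s⁻¹, mul_left_comm s s⁻¹, inv_mul_cancel_left, mul_left_comm]
  · rw [mul_zpow, inv_zpow, zpow_neg, inv_inv]

theorem map_qint
    (hq : Units.map (φ : R →* S) q = s⁻¹ * Units.map (ψ : R →* S) q)
    (hπ : Units.map (φ : R →* S) π = s ^ 2 * Units.map (ψ : R →* S) π)
    (h : IsUnit ((π * q : Rˣ) - (q⁻¹ : Rˣ) : R)) (n : ℤ) :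
    φ (qint q π n) = (s ^ (n - 1) : Sˣ) * ψ (qint q π n) := by
  have h1 := map_qfactor φ ψ s q π hq hπ 1
  rw [zpow_one, zpow_neg_one, zpow_one] at h1
  rw [qint, map_mul, map_mul, map_ringInverse φ h, map_ringInverse ψ h, h1,
    Ring.mul_inverse_rev, map_qfactor φ ψ s q π hq hπ, Ring.inverse_unit, zpow_sub, zpow_one,
    Units.val_mul (s ^ n)]
  ring

/-- This is the exponent of s that a binomial coefficient acquires: numerator weights minus
denominator weights. The upper interval is the lower one translated by n - k, and there are k terms.
-/
theorem sum_Icc_sub (n k : ℕ) :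
    ∑ l ∈ Finset.Icc ((n : ℤ) - k + 1) n, l - ∑ l ∈ Finset.Icc (1 : ℤ) k, l =
      (k : ℤ) * (n - k) := by
  have h : Finset.Icc ((n : ℤ) - k + 1) n =
      (Finset.Icc (1 : ℤ) k).map (addRightEmbedding ((n : ℤ) - k)) := by
    rw [Finset.map_add_right_Icc]; congr 1 <;> ring
  rw [h, Finset.sum_map, ← Finset.sum_sub_distrib]
  simp [addRightEmbedding, mul_sub]

theorem prod_units_zpow {ι : Type*} (t : Finset ι) (f : ι → ℤ) (s : Sˣ) :
    ∏ l ∈ t, ((s ^ f l : Sˣ) : S) = ((s ^ (∑ l ∈ t, f l) : Sˣ) : S) := by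
  classical
  induction t using Finset.induction_on with
  | empty => simp
  | insert a t ha ih =>
    rw [Finset.prod_insert ha, Finset.sum_insert ha, ih, zpow_add, Units.val_mul]

theorem map_qbinom
    (hq : Units.map (φ : R →* S) q = s⁻¹ * Units.map (ψ : R →* S) q)
    (hπ : Units.map (φ : R →* S) π = s ^ 2 * Units.map (ψ : R →* S) π)
    (h : ∀ l : ℤ, 0 < l → IsUnit (((π * q) ^ l : Rˣ) - (q ^ (-l) : Rˣ) : R))
    (n k : ℕ) :
    φ (qbinom q π n k) = (s ^ ((k : ℤ) * (n - k)) : Sˣ) * ψ (qbinom q π n k) := by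
  have hk : IsUnit (∏ l ∈ Finset.Icc (1 : ℤ) k, (((π * q) ^ l : Rˣ) - (q ^ (-l) : Rˣ) : R)) :=
    IsUnit.prod_iff.2 fun l hl => h l (by have := (Finset.mem_Icc.1 hl).1; omega)
  rw [qbinom, map_mul, map_mul, map_ringInverse φ hk, map_ringInverse ψ hk]
  simp only [map_prod]
  simp only [map_qfactor φ ψ s q π hq hπ, Finset.prod_mul_distrib, prod_units_zpow]
  rw [Ring.mul_inverse_rev, Ring.inverse_unit, ← sum_Icc_sub, zpow_sub,
    Units.val_mul]
  ring

end QInt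

/-- ℚ(v)^π has zero divisors, so nonvanishing would not suffice. But x - y divides x² - y², and
squaring removes π, leaving v^{2dl} - v^{-2dl}, a nonzero element of the field ℚ(v). -/
theorem AdjPi_qfactor_isUnit {d : ℕ} (hd : d ≠ 0) {l : ℤ} (hl : l ≠ 0) :
    IsUnit ((((piU Qv ^ d) * (vQvPi ^ d)) ^ l : QvPiˣ) - ((vQvPi ^ d) ^ (-l) : QvPiˣ) : QvPi) := by
  set x : QvPiˣ := ((piU Qv ^ d) * (vQvPi ^ d)) ^ l
  set y : QvPiˣ := (vQvPi ^ d) ^ (-l)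
  suffices h : IsUnit ((x : QvPi) ^ 2 - (y : QvPi) ^ 2) by
    rw [sq_sub_sq] at h
    exact isUnit_of_mul_isUnit_right h
  have hπ : piU Qv ^ 2 = 1 := Units.ext (by simpa [piU] using root_pi_sq Qv)
  have hx : x ^ 2 = Units.map (algebraMap Qv QvPi).toMonoidHom (vQv ^ (2 * d * l : ℤ)) := by
    simp only [x, map_zpow]
    rw [mul_zpow, mul_pow, ← zpow_natCast (piU Qv), ← zpow_mul, ← zpow_natCast, ← zpow_mul,
      mul_comm _ ((2 : ℕ) : ℤ), zpow_mul, zpow_natCast, hπ, one_zpow, one_mul,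
      ← zpow_natCast vQvPi, ← zpow_mul, ← zpow_natCast, ← zpow_mul]
    change vQvPi ^ _ = vQvPi ^ _
    congr 1; push_cast; ring
  have hy : y ^ 2 = Units.map (algebraMap Qv QvPi).toMonoidHom (vQv ^ (-(2 * d * l) : ℤ)) := by
    simp only [y, map_zpow]
    rw [← zpow_natCast vQvPi, ← zpow_mul, ← zpow_natCast, ← zpow_mul]
    change vQvPi ^ _ = vQvPi ^ _
    congr 1; push_cast; ring
  rw [← Units.val_pow_eq_pow_val, ← Units.val_pow_eq_pow_val, hx, hy]
  change IsUnit (algebraMap Qv QvPi _ - algebraMap Qv QvPi _)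
  rw [← map_sub]
  refine IsUnit.map _ ?_
  rw [isUnit_iff_ne_zero, sub_ne_zero]
  intro hab
  have hab' : vQv ^ ((2 * d * l : ℤ) - -(2 * d * l)) = 1 := by
    rw [zpow_sub, Units.ext hab, mul_inv_cancel]
  have := congrArg Units.val hab'
  rw [Units.val_zpow_eq_zpow_val] at this
  refine RatFunc_X_zpow_ne_one ?_ this
  have : (d : ℤ) * l ≠ 0 := mul_ne_zero (by exact_mod_cast hd) hl
  intro h0; apply this; linarith

/-! ### Solutions of the relations of the modified covering quantum group -/

variable {I Y X : Type*} [AddCommGroup Y] [AddCommGroup X]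

section Rep

variable {B : Type*} [NonUnitalRing B]

/-- The value of `E_i^n 1_λ` at an assignment of the generators. -/
def ePow (D : SuperRootDatum I Y X) (g : DotGen I X → B) (i : I) : ℕ → X → B
  | 0, l => g (.one l)
  | n + 1, l => g (.E i (l + n • D.root i)) * ePow D g i n l

/-- The value of `F_i^n 1_λ` at an assignment of the generators. -/
def fPow (D : SuperRootDatum I Y X) (g : DotGen I X → B) (i : I) : ℕ → X → B
  | 0, l => g (.one l)
  | n + 1, l => g (.F i (l - n • D.root i)) * fPow D g i n l

/-- The assignment `g` of values in the `S`-algebra `B` to the generators of the modified covering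
quantum group satisfies the defining relations, where scalars act through `ψ`. -/
structure DotSat {S : Type*} [CommRing S] [Module S B] (D : SuperRootDatum I Y X)
    (ψ : QvPi →+* S) (g : DotGen I X → B) : Prop where
  one_one (l : X) : g (.one l) * g (.one l) = g (.one l)
  one_one_ne (l m : X) (h : l ≠ m) : g (.one l) * g (.one m) = 0
  E_one (i : I) (l : X) : g (.E i l) * g (.one l) = g (.E i l)
  E_one_ne (i : I) (l m : X) (h : l ≠ m) : g (.E i l) * g (.one m) = 0
  one_E (i : I) (l : X) : g (.one (l + D.root i)) * g (.E i l) = g (.E i l)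
  one_E_ne (i : I) (l m : X) (h : m ≠ l + D.root i) : g (.one m) * g (.E i l) = 0
  F_one (i : I) (l : X) : g (.F i l) * g (.one l) = g (.F i l)
  F_one_ne (i : I) (l m : X) (h : l ≠ m) : g (.F i l) * g (.one m) = 0
  one_F (i : I) (l : X) : g (.one (l - D.root i)) * g (.F i l) = g (.F i l)
  one_F_ne (i : I) (l m : X) (h : m ≠ l - D.root i) : g (.one m) * g (.F i l) = 0
  E_F_same (i : I) (l : X) :
    g (.E i (l - D.root i)) * g (.F i l) -
        ψ ((piU Qv : QvPi) ^ (D.p i * D.p i)) • (g (.F i (l + D.root i)) * g (.E i l)) =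
      ψ (qint (vi D.toSuperCartanDatum i) (pii D.toSuperCartanDatum i)
        (D.pairing (D.coroot i) l)) • g (.one l)
  E_F_ne (i j : I) (l : X) (h : i ≠ j) :
    g (.E i (l - D.root j)) * g (.F j l) -
        ψ ((piU Qv : QvPi) ^ (D.p i * D.p j)) • (g (.F j (l + D.root i)) * g (.E i l)) = 0
  serre_E (i j : I) (l : X) (h : i ≠ j) :
    ∑ k ∈ Finset.range (D.b i j + 1), ψ (serreCoeff D.toSuperCartanDatum i j k) •
        (ePow D g i (D.b i j - k) (l + k • D.root i + D.root j) *
          g (.E j (l + k • D.root i)) * ePow D g i k l) = 0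
  serre_F (i j : I) (l : X) (h : i ≠ j) :
    ∑ k ∈ Finset.range (D.b i j + 1), ψ (serreCoeff D.toSuperCartanDatum i j k) •
        (fPow D g i (D.b i j - k) (l - k • D.root i - D.root j) *
          g (.F j (l - k • D.root i)) * fPow D g i k l) = 0

section Map

variable {B' : Type*} [NonUnitalRing B'] (f : B →ₙ+* B') (D : SuperRootDatum I Y X)

theorem map_ePow (g : DotGen I X → B) (i : I) (n : ℕ) (l : X) :
    f (ePow D g i n l) = ePow D (fun x => f (g x)) i n l := by
  induction n with
  | zero => rfl
  | succ n ih => rw [ePow, map_mul, ih]; rfl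

theorem map_fPow (g : DotGen I X → B) (i : I) (n : ℕ) (l : X) :
    f (fPow D g i n l) = fPow D (fun x => f (g x)) i n l := by
  induction n with
  | zero => rfl
  | succ n ih => rw [fPow, map_mul, ih]; rfl

/-- Semilinear homomorphisms preserve solutions of the relations. -/
theorem DotSat.map {S S' : Type*} [CommRing S] [CommRing S'] [Module S B] [Module S' B']
    {D : SuperRootDatum I Y X} {ψ : QvPi →+* S} {g : DotGen I X → B} (h : DotSat D ψ g)
    {θ : S →+* S'} (hf : ∀ c b, f (c • b) = θ c • f b) :
    DotSat D (θ.comp ψ) fun x => f (g x) where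
  one_one l := by simp only [← map_mul, h.one_one]
  one_one_ne l m hlm := by simp only [← map_mul, h.one_one_ne l m hlm, map_zero]
  E_one i l := by simp only [← map_mul, h.E_one]
  E_one_ne i l m hlm := by simp only [← map_mul, h.E_one_ne i l m hlm, map_zero]
  one_E i l := by simp only [← map_mul, h.one_E]
  one_E_ne i l m hlm := by simp only [← map_mul, h.one_E_ne i l m hlm, map_zero]
  F_one i l := by simp only [← map_mul, h.F_one]
  F_one_ne i l m hlm := by simp only [← map_mul, h.F_one_ne i l m hlm, map_zero]
  one_F i l := by simp only [← map_mul, h.one_F]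
  one_F_ne i l m hlm := by simp only [← map_mul, h.one_F_ne i l m hlm, map_zero]
  E_F_same i l := by
    simp only [← map_mul, RingHom.comp_apply, ← hf, ← map_sub, h.E_F_same]
  E_F_ne i j l hij := by
    simp only [← map_mul, RingHom.comp_apply, ← hf, ← map_sub, h.E_F_ne i j l hij, map_zero]
  serre_E i j l hij := by
    simp only [← map_ePow, ← map_mul, RingHom.comp_apply, ← hf, ← map_sum, h.serre_E i j l hij,
      map_zero]
  serre_F i j l hij := by
    simp only [← map_fPow, ← map_mul, RingHom.comp_apply, ← hf, ← map_sum, h.serre_F i j l hij,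
      map_zero]

end Map

end Rep

/-! ### The universal solution -/

theorem mkAlgHom_dotEpow (D : SuperRootDatum I Y X) (i : I) (n : ℕ) (l : X) :
    RingQuot.mkAlgHom QvPi (DotRel D) (dotEpow D i n l) = ePow D (dotMk D) i n l := by
  induction n with
  | zero => rfl
  | succ n ih => rw [dotEpow, map_mul, ih]; rfl

theorem mkAlgHom_dotFpow (D : SuperRootDatum I Y X) (i : I) (n : ℕ) (l : X) :
    RingQuot.mkAlgHom QvPi (DotRel D) (dotFpow D i n l) = fPow D (dotMk D) i n l := by
  induction n with
  | zero => rfl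
  | succ n ih => rw [dotFpow, map_mul, ih]; rfl

theorem dotMk_sat (D : SuperRootDatum I Y X) : DotSat D (RingHom.id QvPi) (dotMk D) := by
  have key : ∀ {x y}, DotRel D x y → RingQuot.mkAlgHom QvPi (DotRel D) x =
    RingQuot.mkAlgHom QvPi (DotRel D) y := fun h => RingQuot.mkAlgHom_rel QvPi h
  constructor
  · intro l; simpa [dotMk] using key (.one_one l)
  · intro l m h; simpa [dotMk] using key (.one_one_ne l m h)
  · intro i l; simpa [dotMk] using key (.E_one i l)
  · intro i l m h; simpa [dotMk] using key (.E_one_ne i l m h)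
  · intro i l; simpa [dotMk] using key (.one_E i l)
  · intro i l m h; simpa [dotMk] using key (.one_E_ne i l m h)
  · intro i l; simpa [dotMk] using key (.F_one i l)
  · intro i l m h; simpa [dotMk] using key (.F_one_ne i l m h)
  · intro i l; simpa [dotMk] using key (.one_F i l)
  · intro i l m h; simpa [dotMk] using key (.one_F_ne i l m h)
  · intro i l
    have := key (.E_F_same i l)
    simp only [map_sub, map_smul, map_mul] at this
    exact this
  · intro i j l h
    have := key (.E_F_ne i j l h)
    simp only [map_sub, map_smul, map_mul, map_zero] at this
    exact this
  · intro i j l h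
    have := key (.serre_E i j l h)
    simp only [map_sum, map_smul, map_mul, map_zero, mkAlgHom_dotEpow] at this
    exact this
  · intro i j l h
    have := key (.serre_F i j l h)
    simp only [map_sum, map_smul, map_mul, map_zero, mkAlgHom_dotFpow] at this
    exact this

/-- Serves to pull the relations from the ambient unital algebra, where they hold by construction,
back to the non-unital subalgebra 𝐔̇. -/
theorem DotSat.of_injective {B B' : Type*} [NonUnitalRing B] [NonUnitalRing B'] {S : Type*}
    [CommRing S] [Module S B] [Module S B'] {D : SuperRootDatum I Y X} {ψ : QvPi →+* S}
    {g : DotGen I X → B} (f : B →ₙ+* B') (hf : ∀ (c : S) b, f (c • b) = c • f b)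
    (hinj : Function.Injective f) (h : DotSat D ψ fun x => f (g x)) : DotSat D ψ g where
  one_one l := hinj (by simpa using h.one_one l)
  one_one_ne l m hlm := hinj (by simpa using h.one_one_ne l m hlm)
  E_one i l := hinj (by simpa using h.E_one i l)
  E_one_ne i l m hlm := hinj (by simpa using h.E_one_ne i l m hlm)
  one_E i l := hinj (by simpa using h.one_E i l)
  one_E_ne i l m hlm := hinj (by simpa using h.one_E_ne i l m hlm)
  F_one i l := hinj (by simpa using h.F_one i l)
  F_one_ne i l m hlm := hinj (by simpa using h.F_one_ne i l m hlm)
  one_F i l := hinj (by simpa using h.one_F i l)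
  one_F_ne i l m hlm := hinj (by simpa using h.one_F_ne i l m hlm)
  E_F_same i l := hinj (by simpa only [map_sub, map_mul, hf] using h.E_F_same i l)
  E_F_ne i j l hij := hinj (by simpa only [map_sub, map_mul, hf, map_zero] using h.E_F_ne i j l hij)
  serre_E i j l hij := hinj (by
    simpa only [map_sum, map_mul, hf, map_zero, map_ePow] using h.serre_E i j l hij)
  serre_F i j l hij := hinj (by
    simpa only [map_sum, map_mul, hf, map_zero, map_fPow] using h.serre_F i j l hij)

theorem Udot_of_sat (D : SuperRootDatum I Y X) : DotSat D (RingHom.id QvPi) (Udot.of D) :=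
  DotSat.of_injective (NonUnitalSubalgebraClass.subtype (UdotSubalgebra D) :
    Udot D →ₙ+* RingQuot (DotRel D)) (fun _ _ => rfl) Subtype.val_injective (dotMk_sat D)

/-- The homomorphism `x ↦ 1 ⊗ x`. -/
def includeUdott (D : SuperRootDatum I Y X) : Udot D →ₙ+* Udott D where
  toFun x := 1 ⊗ₜ x
  map_mul' x y := by rw [Algebra.TensorProduct.tmul_mul_tmul, mul_one]
  map_zero' := TensorProduct.tmul_zero _ _
  map_add' x y := TensorProduct.tmul_add _ _ _

theorem includeUdott_smul (D : SuperRootDatum I Y X) (c : QvPi) (x : Udot D) :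
    includeUdott D (c • x) = algebraMap QvPi QvtPi c • includeUdott D x := by
  change (1 : QvtPi) ⊗ₜ[QvPi] (c • x) = algebraMap QvPi QvtPi c • ((1 : QvtPi) ⊗ₜ[QvPi] x)
  rw [← TensorProduct.smul_tmul, TensorProduct.smul_tmul', Algebra.smul_def, smul_eq_mul]

theorem Udott_of_sat (D : SuperRootDatum I Y X) :
    DotSat D (algebraMap QvPi QvtPi) (Udott.of D) :=
  (Udot_of_sat D).map (includeUdott D) (includeUdott_smul D)

/-- Since 𝐔̇ is generated without a unit, no case for constants is needed; pure tensors are handled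
as c ⊗ u = c • (1 ⊗ u). -/
theorem Udott_induction {D : SuperRootDatum I Y X} {p : Udott D → Prop}
    (of : ∀ x, p (Udott.of D x)) (zero : p 0) (add : ∀ x y, p x → p y → p (x + y))
    (mul : ∀ x y, p x → p y → p (x * y)) (smul : ∀ (c : QvtPi) x, p x → p (c • x))
    (x : Udott D) : p x := by
  have key : ∀ u : Udot D, p (includeUdott D u) := by
    rintro ⟨u, hu⟩
    induction hu using NonUnitalAlgebra.adjoin_induction with
    | mem a ha => obtain ⟨y, rfl⟩ := ha; exact of y
    | add a b ha hb iha ihb =>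
      have := add _ _ iha ihb
      rwa [← map_add] at this
    | zero => exact (map_zero (includeUdott D)).symm ▸ zero
    | mul a b ha hb iha ihb =>
      have := mul _ _ iha ihb
      rwa [← map_mul] at this
    | smul r a ha iha =>
      have := smul (algebraMap QvPi QvtPi r) _ iha
      rwa [← includeUdott_smul] at this
  induction x using TensorProduct.induction_on with
  | zero => exact zero
  | tmul c u =>
    have := smul c _ (key u)
    change p (c • ((1 : QvtPi) ⊗ₜ[QvPi] u)) at this
    rwa [TensorProduct.smul_tmul', smul_eq_mul, mul_one] at this
  | add x y hx hy => exact add _ _ hx hy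

/-- A semilinear homomorphism on `𝐔̇[𝐭]` is determined by its values on the generators. -/
theorem Udott_hom_ext {D : SuperRootDatum I Y X} {S B : Type*} [CommRing S] [NonUnitalRing B]
    [Module S B] {f g : Udott D →ₙ+* B} (θ : QvtPi →+* S) (hf : ∀ c x, f (c • x) = θ c • f x)
    (hg : ∀ c x, g (c • x) = θ c • g x) (h : ∀ x, f (Udott.of D x) = g (Udott.of D x)) :
    f = g := by
  refine NonUnitalRingHom.ext fun x => ?_
  induction x using Udott_induction with
  | of x => exact h x
  | zero => rw [map_zero, map_zero]
  | add x y hx hy => rw [map_add, map_add, hx, hy]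
  | mul x y hx hy => rw [map_mul, map_mul, hx, hy]
  | smul c x hx => rw [hf, hg, hx]

/-! ### The universal property -/

section Lift

variable {S B : Type*} [CommRing S]

/-- The homomorphism from the unital algebra with the presentation of the modified covering
quantum group that is given by a solution of the relations in a unital algebra. -/
theorem exists_dotLift_unital [Ring B] [Algebra S B] {D : SuperRootDatum I Y X} {ψ : QvPi →+* S}
    {g : DotGen I X → B} (h : DotSat D ψ g) :
    ∃ f : RingQuot (DotRel D) →+* B, (∀ x, f (dotMk D x) = g x) ∧
      ∀ (c : QvPi) x, f (c • x) = ψ c • f x := by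
  -- Letting ℚ(v)^π act through ψ turns the ψ-semilinear problem into a linear one, to which the
  -- universal property of the free algebra applies.
  let _ : Algebra QvPi B := ((algebraMap S B).comp ψ).toAlgebra' fun c x =>
    Algebra.commutes (ψ c) x
  have hsmul : ∀ (c : QvPi) (b : B), c • b = ψ c • b := fun c b => by
    rw [Algebra.smul_def, Algebra.smul_def]; rfl
  have hgen : ∀ x, FreeAlgebra.lift QvPi g (dgen x) = g x := fun x => FreeAlgebra.lift_ι_apply g x
  have hE : ∀ i n l, FreeAlgebra.lift QvPi g (dotEpow D i n l) = ePow D g i n l := by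
    intro i n l
    induction n with
    | zero => exact hgen _
    | succ n ih => rw [dotEpow, map_mul, ih, hgen]; rfl
  have hF : ∀ i n l, FreeAlgebra.lift QvPi g (dotFpow D i n l) = fPow D g i n l := by
    intro i n l
    induction n with
    | zero => exact hgen _
    | succ n ih => rw [dotFpow, map_mul, ih, hgen]; rfl
  have hrel : ∀ ⦃x y⦄, DotRel D x y → FreeAlgebra.lift QvPi g x = FreeAlgebra.lift QvPi g y := by
    intro x y hxy
    cases hxy <;>
    simp only [map_mul, map_sub, map_sum, map_zero, map_smul, hgen, hE, hF, hsmul]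
    · exact h.one_one _
    · exact h.one_one_ne _ _ ‹_›
    · exact h.E_one _ _
    · exact h.E_one_ne _ _ _ ‹_›
    · exact h.one_E _ _
    · exact h.one_E_ne _ _ _ ‹_›
    · exact h.F_one _ _
    · exact h.F_one_ne _ _ _ ‹_›
    · exact h.one_F _ _
    · exact h.one_F_ne _ _ _ ‹_›
    · exact h.E_F_same _ _
    · exact h.E_F_ne _ _ _ ‹_›
    · exact h.serre_E _ _ _ ‹_›
    · exact h.serre_F _ _ _ ‹_›
  refine ⟨(RingQuot.liftAlgHom QvPi ⟨FreeAlgebra.lift QvPi g, hrel⟩ :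
    RingQuot (DotRel D) →ₐ[QvPi] B), fun x => ?_, fun c x => ?_⟩
  · exact (RingQuot.liftAlgHom_mkAlgHom_apply QvPi _ hrel (dgen x)).trans (hgen x)
  · rw [← hsmul]; exact map_smul (RingQuot.liftAlgHom QvPi _ : RingQuot (DotRel D) →ₐ[QvPi] B) c x

variable [NonUnitalRing B] [Module S B] [IsScalarTower S B B] [SMulCommClass S B B]

/-- The target may lack a unit, as 𝐔̇[𝐭] itself does, so the lift is first made into the unitization
S ⊕ B. The generators land in B, hence so does the non-unital subalgebra they generate. On elements
with vanishing S-component, the projection to B is multiplicative. -/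
theorem exists_dotLift_nonUnital {D : SuperRootDatum I Y X} {ψ : QvPi →+* S}
    {g : DotGen I X → B} (h : DotSat D ψ g) :
    ∃ f : Udot D →ₙ+* B, (∀ x, f (Udot.of D x) = g x) ∧
      ∀ (c : QvPi) x, f (c • x) = ψ c • f x := by
  have h' := h.map (Unitization.inrNonUnitalAlgHom S B : B →ₙ+* Unitization S B)
    (θ := RingHom.id S) (fun c b => Unitization.inr_smul S c b)
  obtain ⟨F, hF, hFs⟩ := exists_dotLift_unital h'
  have h0 : ∀ u : Udot D, (F u).fst = 0 := by
    rintro ⟨u, hu⟩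
    induction hu using NonUnitalAlgebra.adjoin_induction with
    | mem a ha =>
      obtain ⟨y, rfl⟩ := ha
      change (F (dotMk D y)).fst = 0
      rw [hF]; exact Unitization.fst_inr S (g y)
    | add a b ha hb iha ihb =>
      change (F (a + b)).fst = 0
      rw [map_add, Unitization.fst_add]
      exact (congrArg₂ (· + ·) iha ihb).trans (add_zero 0)
    | zero => change (F 0).fst = 0; rw [map_zero]; rfl
    | mul a b ha hb iha ihb =>
      change (F (a * b)).fst = 0
      rw [map_mul, Unitization.fst_mul]
      exact (congrArg (· * _) iha).trans (zero_mul _)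
    | smul r a ha iha =>
      change (F (r • a)).fst = 0
      rw [hFs, Unitization.fst_smul]
      exact (congrArg (_ • ·) iha).trans (smul_zero _)
  refine ⟨⟨⟨fun u => (F u).snd, fun u v => ?_⟩, ?_, fun u v => ?_⟩, fun x => ?_, fun c u => ?_⟩
  · change (F (u * v)).snd = _
    rw [map_mul, Unitization.snd_mul, h0, h0, zero_smul, zero_smul, zero_add, zero_add]
  · change (F 0).snd = 0
    rw [map_zero, Unitization.snd_zero]
  · change (F (u + v)).snd = _
    rw [map_add, Unitization.snd_add]
  · change (F (dotMk D x)).snd = g x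
    rw [hF]; exact Unitization.snd_inr S (g x)
  · exact (congrArg (·.snd) (hFs c (u : RingQuot (DotRel D)))).trans
      (Unitization.snd_smul _ _)

/-- The universal property of `𝐔̇[𝐭]`. -/
theorem exists_dotLift {D : SuperRootDatum I Y X} (θ : QvtPi →+* S)
    {g : DotGen I X → B} (h : DotSat D (θ.comp (algebraMap QvPi QvtPi)) g) :
    ∃ f : Udott D →ₙ+* B, (∀ x, f (Udott.of D x) = g x) ∧
      ∀ (c : QvtPi) x, f (c • x) = θ c • f x := by
  obtain ⟨f₀, hf₀, hf₀s⟩ := exists_dotLift_nonUnital h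
  -- The map c ⊗ u ↦ θ(c) f₀(u) is only θ-semilinear, so it is built as a balanced biadditive
  -- pairing. It is balanced over ℚ(v)^π by `hf₀s`.
  let f₁ : QvtPi →+ Udot D →+ B := AddMonoidHom.mk'
    (fun c => (DistribSMul.toAddMonoidHom B (θ c)).comp (f₀ : Udot D →+ B))
    (fun c d => by ext u; simp [add_smul])
  have hf₁ : ∀ c u, f₁ c u = θ c • f₀ u := fun _ _ => rfl
  let f₂ : Udott D →+ B := TensorProduct.liftAddHom f₁ fun r c u => by
    rw [hf₁, hf₁, hf₀s, smul_smul, Algebra.smul_def, mul_comm, map_mul, RingHom.comp_apply]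
  have hf₂ : ∀ (c : QvtPi) (u : Udot D), f₂ (c ⊗ₜ u) = θ c • f₀ u := fun _ _ => rfl
  have hmul : ∀ x y : Udott D, f₂ (x * y) = f₂ x * f₂ y := by
    intro x y
    induction x using TensorProduct.induction_on with
    | zero => simp only [zero_mul, map_zero]
    | add x x' hx hx' => rw [add_mul x x' y, map_add f₂, map_add f₂, hx, hx', add_mul]
    | tmul c u =>
      induction y using TensorProduct.induction_on with
      | zero => simp only [mul_zero, map_zero]
      | add y y' hy hy' => rw [mul_add _ y y', map_add f₂, map_add f₂, hy, hy', mul_add]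
      | tmul d v =>
        refine (congrArg f₂ (Algebra.TensorProduct.tmul_mul_tmul c d u v)).trans ?_
        rw [hf₂, hf₂, hf₂, map_mul, map_mul, smul_mul_smul_comm]
  refine ⟨⟨⟨f₂, hmul⟩, map_zero f₂, map_add f₂⟩, fun x => ?_, fun c x => ?_⟩
  · change f₂ ((1 : QvtPi) ⊗ₜ Udot.of D x) = _
    rw [hf₂, map_one, one_smul, hf₀]
  · change f₂ (c • x) = θ c • f₂ x
    induction x using TensorProduct.induction_on with
    | zero => rw [smul_zero, map_zero, smul_zero]
    | add x x' hx hx' => rw [smul_add, map_add, map_add, hx, hx', smul_add]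
    | tmul d u => rw [TensorProduct.smul_tmul', hf₂, hf₂, smul_eq_mul, map_mul, mul_smul]

end Lift

/-! ### Arithmetic of super Cartan data -/

namespace SuperCartanDatum

variable {I : Type*} (D : SuperCartanDatum I)

theorem two_mul_d (i : I) : 2 * (D.d i : ℤ) = D.dot i i := by
  have h1 := D.dot_self_even i
  have h2 := D.dot_self_pos i
  rw [d]; omega

theorem d_pos (i : I) : 0 < (D.d i : ℤ) := by
  have h1 := D.two_mul_d i
  have h2 := D.dot_self_pos i
  omega

theorem d_mul_a (i j : I) : (D.d i : ℤ) * D.a i j = D.dot i j := by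
  have h : D.dot i i * D.a i j = 2 * D.dot i j := Int.mul_ediv_cancel' (D.dot_dvd i j)
  rw [← D.two_mul_d] at h
  linarith

/-- The truncation in `toNat` is harmless because aᵢⱼ ≤ 0. -/
theorem b_cast {i j : I} (h : i ≠ j) : (D.b i j : ℤ) = 1 - D.a i j := by
  have h1 : D.a i j ≤ 0 := by
    have h2 := D.d_mul_a i j
    have h3 := D.dot_nonpos i j h
    have h4 := D.d_pos i
    by_contra! h5
    have := mul_pos h4 h5
    omega
  rw [b]; omega

/-- This is bar-consistency. It makes the sign π ↦ -π, governed by p(i) in the relations, compatible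
with the factors 𝐭^{dᵢ} coming from vᵢ. -/
theorem exists_p_sub_d (i : I) : ∃ m : ℤ, (D.p i : ℤ) - D.d i = 2 * m := by
  have h1 := D.bar_consistent i
  have h2 := D.two_mul_d i
  have h3 : D.dot i i / 2 = D.d i := by omega
  rw [h3] at h1
  exact Int.modEq_iff_dvd.1 h1

theorem p_mul_self (i : I) : D.p i * D.p i = D.p i := by
  have : D.p i < 2 := (D.parity i).isLt
  interval_cases D.p i <;> rfl

/-- In i·j = dᵢaᵢⱼ the factor dᵢ is even if i is even (bar-consistency), and the factor aᵢⱼ is even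
if i is odd (the parity condition on the datum). -/
theorem exists_dot_even (i j : I) : ∃ e : ℤ, D.dot i j = 2 * e := by
  rw [← D.d_mul_a]
  obtain ⟨m, hm⟩ := D.exists_p_sub_d i
  have hp : D.p i < 2 := (D.parity i).isLt
  rcases Nat.lt_or_ge (D.p i) 1 with h | h
  · exact ⟨-m * D.a i j, by
      have : (D.p i : ℤ) = 0 := by omega
      have h' : (D.d i : ℤ) = -(2 * m) := by omega
      rw [h']; ring⟩
  · have h1 : D.parity i = 1 := Fin.ext (by change D.p i = 1; omega)
    obtain ⟨c, hc⟩ := D.odd_even i j h1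
    exact ⟨D.d i * c, by rw [a, hc]; ring⟩

variable [LinearOrder I]

theorem phi_self (i : I) : D.phi i i = D.d i := by simp [phi]

/-- The form `φ` measures the failure of symmetry. -/
theorem exists_phi_sub {i j : I} (h : i ≠ j) :
    ∃ r : ℤ, D.phi i j - D.phi j i = D.dot i j + 2 * D.p i * D.p j + 4 * r := by
  obtain ⟨e, he⟩ := D.exists_dot_even i j
  rcases lt_or_gt_of_ne h with hlt | hlt
  -- For i < j the difference is -i·j - 2p(i)p(j), which agrees with i·j + 2p(i)p(j) modulo 4 only
  -- because i·j = 2e is even.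
  · refine ⟨-(D.p i * D.p j) - e, ?_⟩
    rw [phi, phi, if_neg hlt.not_gt, if_neg h.symm, if_pos hlt, d_mul_a, D.dot_symm j i, he]
    ring
  · refine ⟨0, ?_⟩
    rw [phi, phi, if_pos hlt, if_neg hlt.not_gt, if_neg h, d_mul_a]
    ring

end SuperCartanDatum


theorem SuperRootDatum.pairing_root (D : SuperRootDatum I Y X) (i j : I) :
    D.pairing (D.coroot i) (D.root j) = D.a i j := D.pairing_coroot_root i j

/-! ### The function φ̇ under translation by roots -/

section Dotphi

variable [Fintype I] [LinearOrder I] (D : SuperRootDatum I Y X) (C : Transversal D)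

theorem dotphi_eq (i : I) (x : (I → ℤ) × C.carrier) :
    dotphi D C i ((∑ j, x.1 j • D.root j) + x.2) = ∑ j, x.1 j * D.phi i j := by
  have h := C.existsUnique_rep ((∑ j, x.1 j • D.root j) + x.2)
  have hx : h.choose = x := (h.choose_spec.2 x rfl).symm
  rw [dotphi, hx]

/-- Adding a root changes only the ℤ[I]-component of the weight and keeps its representative in the
transversal. -/
theorem dotphi_add_root (i j : I) (l : X) :
    dotphi D C i (l + D.root j) = dotphi D C i l + D.phi i j := by
  obtain ⟨x, rfl, -⟩ := C.existsUnique_rep l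
  have h := dotphi_eq D C i (x.1 + Pi.single j 1, x.2)
  have h1 : ∑ k, (x.1 + Pi.single j 1 : I → ℤ) k • D.root k =
      (∑ k, x.1 k • D.root k) + D.root j := by
    simp [add_smul, Finset.sum_add_distrib, Pi.single_apply]
  have h2 : ∑ k, (x.1 + Pi.single j 1 : I → ℤ) k * D.phi i k =
      (∑ k, x.1 k * D.phi i k) + D.phi i j := by
    simp [add_mul, Finset.sum_add_distrib, Pi.single_apply]
  simp only [h1, h2] at h
  rw [dotphi_eq, ← h, add_right_comm]

end Dotphi

/-! ### Twisting solutions of the relations by powers of `𝐭` -/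

theorem two_mul_choose_two (k : ℕ) : 2 * ((k.choose 2 : ℕ) : ℤ) = k * (k - 1) := by
  induction k with
  | zero => simp
  | succ k ih => rw [Nat.choose_succ_succ' k 1, Nat.choose_one_right]; push_cast; linarith

theorem choose_two_add (n m : ℕ) :
    (((n + m).choose 2 : ℕ) : ℤ) = n.choose 2 + m.choose 2 + n * m := by
  have h1 := two_mul_choose_two (n + m)
  have h2 := two_mul_choose_two n
  have h3 := two_mul_choose_two m
  push_cast at h1
  linarith

section Twist

variable {S B : Type*} [CommRing S] [NonUnitalRing B] [Module S B]

/-- Reduces each comparison of powers of t below to a congruence modulo 4 with an explicit quotient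
m. -/
theorem zpow_eq_of_sub_eq_four_mul {G : Type*} [Group G] {t : G} (ht : t ^ 4 = 1) {a b : ℤ} (m : ℤ)
    (h : a - b = 4 * m) : t ^ a = t ^ b := by
  rw [← mul_inv_eq_one, ← zpow_sub, h, zpow_mul]
  rw [show t ^ (4 : ℤ) = t ^ 4 from zpow_natCast t 4, ht, one_zpow]

/-- Rescaling of `E_i 1_λ` and `F_i 1_λ` by powers of `t`. -/
def twistGen (t : Sˣ) (α β : I → X → ℤ) (g : DotGen I X → B) : DotGen I X → B
  | .one l => g (.one l)
  | .E i l => t ^ α i l • g (.E i l)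
  | .F i l => t ^ β i l • g (.F i l)

/-- The effect of the automorphism `π ↦ -π`, `v ↦ 𝐭⁻¹ v` on scalars. -/
structure ScalarTwist (ψ φ : QvPi →+* S) (t : Sˣ) : Prop where
  t_sq : t ^ 2 = -1
  map_pi : φ (piU Qv : QvPiˣ) = -ψ (piU Qv : QvPiˣ)
  map_v : Units.map (φ : QvPi →* S) vQvPi = t⁻¹ * Units.map (ψ : QvPi →* S) vQvPi

/-! ### The scalar twist on the structure constants -/

namespace ScalarTwist

variable {ψ φ : QvPi →+* S} {t : Sˣ} (h : ScalarTwist ψ φ t) (D : SuperCartanDatum I)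
include h

theorem t_four : t ^ 4 = 1 := by
  rw [show 4 = 2 * 2 from rfl, pow_mul, h.t_sq]; simp

/-- Writing the sign -1 as t² brings π into the form required by `map_qfactor`. Raised to the power
dᵢ, it gives that form with s = t^{dᵢ}. -/
theorem units_map_pi :
    Units.map (φ : QvPi →* S) (piU Qv) = t ^ 2 * Units.map (ψ : QvPi →* S) (piU Qv) := by
  rw [h.t_sq]
  exact Units.ext (by simpa using h.map_pi)

theorem units_map_vi (i : I) : Units.map (φ : QvPi →* S) (vi D i) =
    (t ^ D.d i)⁻¹ * Units.map (ψ : QvPi →* S) (vi D i) := by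
  rw [vi, map_pow, map_pow, h.map_v, mul_pow, inv_pow]

theorem units_map_pii (i : I) : Units.map (φ : QvPi →* S) (pii D i) =
    (t ^ D.d i) ^ 2 * Units.map (ψ : QvPi →* S) (pii D i) := by
  rw [pii, map_pow, map_pow, h.units_map_pi, mul_pow, pow_right_comm]

theorem map_pi_pow (n : ℕ) : φ ((piU Qv : QvPi) ^ n) =
    ((t ^ (2 * n : ℤ) : Sˣ) : S) * ψ ((piU Qv : QvPi) ^ n) := by
  have h2 : ((t ^ (2 * n : ℤ) : Sˣ) : S) = (-1) ^ n := by
    rw [zpow_mul, show t ^ (2 : ℤ) = t ^ 2 from zpow_natCast t 2, h.t_sq, zpow_natCast]; simp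
  rw [map_pow, h.map_pi, h2, map_pow, neg_pow]

theorem map_qint (i : I) (n : ℤ) : φ (qint (vi D i) (pii D i) n) =
    ((t ^ (D.d i * (n - 1)) : Sˣ) : S) * ψ (qint (vi D i) (pii D i) n) := by
  have hd : D.d i ≠ 0 := by have := D.d_pos i; omega
  rw [CoveringQG.map_qint φ ψ (t ^ D.d i) _ _ (h.units_map_vi D i) (h.units_map_pii D i) ?_ n,
    zpow_mul, zpow_natCast]
  have := AdjPi_qfactor_isUnit hd one_ne_zero
  rwa [zpow_one, zpow_neg_one] at this

/-- Each π contributes t², and the binomial coefficient contributes s^{k(b-k)} with s = t^{dᵢ}. -/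
theorem map_serreCoeff (i j : I) (k : ℕ) : φ (serreCoeff D i j k) =
    ((t ^ (2 * ((k.choose 2 : ℕ) * D.p i + k * D.p i * D.p j) + D.d i * (k * (D.b i j - k)) : ℤ)
      : Sˣ) : S) * ψ (serreCoeff D i j k) := by
  have hd : D.d i ≠ 0 := by have := D.d_pos i; omega
  rw [serreCoeff, map_mul, map_mul, map_mul, map_mul, h.map_pi_pow,
    CoveringQG.map_qbinom φ ψ (t ^ D.d i) _ _ (h.units_map_vi D i) (h.units_map_pii D i)
      fun l hl => AdjPi_qfactor_isUnit hd hl.ne', zpow_add, zpow_mul t (D.d i),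
    zpow_natCast t (D.d i)]
  simp only [map_pow, map_neg, map_one, Units.val_mul]
  push_cast
  ring

end ScalarTwist

/-! ### Rescaled generators satisfy the twisted relations -/

variable [IsScalarTower S B B] [SMulCommClass S B B]

/-- The exponents in the twistor. -/
structure TwistExponents [LinearOrder I] (D : SuperRootDatum I Y X) (α β : I → X → ℤ) :
    Prop where
  add_eq (i : I) (l : X) : α i l + β i l = D.d i * D.pairing (D.coroot i) l
  β_add (i j : I) (l : X) : β i (l + D.root j) = β i l + D.phi i j

namespace TwistExponents

variable [LinearOrder I] {D : SuperRootDatum I Y X} {α β : I → X → ℤ} (h : TwistExponents D α β)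
include h

/-- Along j' the sum of the two exponents grows by dᵢaᵢⱼ = i·j, of which β takes φ(i,j). -/
theorem α_add (i j : I) (l : X) :
    α i (l + D.root j) = α i l + (D.dot i j - D.phi i j) := by
  have h1 := h.add_eq i l
  have h2 := h.add_eq i (l + D.root j)
  have h3 := h.β_add i j l
  rw [map_add, D.pairing_root, mul_add, D.d_mul_a] at h2
  linarith

theorem α_sub (i j : I) (l : X) :
    α i (l - D.root j) = α i l - (D.dot i j - D.phi i j) := by
  have := h.α_add i j (l - D.root j)
  rw [sub_add_cancel] at this
  linarith

theorem β_sub (i j : I) (l : X) : β i (l - D.root j) = β i l - D.phi i j := by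
  have := h.β_add i j (l - D.root j)
  rw [sub_add_cancel] at this
  linarith

theorem α_add_nsmul (i j : I) (n : ℕ) (l : X) :
    α i (l + n • D.root j) = α i l + n * (D.dot i j - D.phi i j) := by
  induction n with
  | zero => simp
  | succ n ih => rw [succ_nsmul, ← add_assoc, h.α_add, ih]; push_cast; ring

theorem β_sub_nsmul (i j : I) (n : ℕ) (l : X) :
    β i (l - n • D.root j) = β i l - n * D.phi i j := by
  induction n with
  | zero => simp
  | succ n ih => rw [succ_nsmul, ← sub_sub, h.β_sub, ih]; push_cast; ring

/-- The exponents along the string form an arithmetic progression with step i·i - φ(i,i) = 2dᵢ - dᵢ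
= dᵢ, whence the binomial coefficient. -/
theorem ePow_twistGen (t : Sˣ) (g : DotGen I X → B) (i : I) (n : ℕ) (l : X) :
    ePow D (twistGen t α β g) i n l =
      t ^ (n * α i l + D.d i * (n.choose 2 : ℕ)) • ePow D g i n l := by
  induction n with
  | zero => simp [ePow, twistGen]
  | succ n ih =>
    rw [ePow, ih, ePow, twistGen, smul_mul_smul_comm, ← zpow_add]
    congr 2
    rw [h.α_add_nsmul, D.phi_self, ← D.two_mul_d, Nat.choose_succ_succ' n 1, Nat.choose_one_right]
    push_cast; ring

/-- Same summation, now downwards with step -φ(i,i) = -dᵢ. -/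
theorem fPow_twistGen (t : Sˣ) (g : DotGen I X → B) (i : I) (n : ℕ) (l : X) :
    fPow D (twistGen t α β g) i n l =
      t ^ (n * β i l - D.d i * (n.choose 2 : ℕ)) • fPow D g i n l := by
  induction n with
  | zero => simp [fPow, twistGen]
  | succ n ih =>
    rw [fPow, ih, fPow, twistGen, smul_mul_smul_comm, ← zpow_add]
    congr 2
    rw [h.β_sub_nsmul, D.phi_self, Nat.choose_succ_succ' n 1, Nat.choose_one_right]
    push_cast; ring

/-- Twisting by powers of `t` turns solutions into solutions. -/
theorem dotSat {ψ φ : QvPi →+* S} {t : Sˣ} (hs : ScalarTwist ψ φ t) {g : DotGen I X → B}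
    (hg : DotSat D ψ g) : DotSat D φ (twistGen t α β g) where
  one_one l := hg.one_one l
  one_one_ne l m hlm := hg.one_one_ne l m hlm
  E_one i l := by simp only [twistGen, smul_mul_assoc, hg.E_one]
  E_one_ne i l m hlm := by simp only [twistGen, smul_mul_assoc, hg.E_one_ne i l m hlm, smul_zero]
  one_E i l := by simp only [twistGen, mul_smul_comm, hg.one_E]
  one_E_ne i l m hlm := by simp only [twistGen, mul_smul_comm, hg.one_E_ne i l m hlm, smul_zero]
  F_one i l := by simp only [twistGen, smul_mul_assoc, hg.F_one]
  F_one_ne i l m hlm := by simp only [twistGen, smul_mul_assoc, hg.F_one_ne i l m hlm, smul_zero]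
  one_F i l := by simp only [twistGen, mul_smul_comm, hg.one_F]
  one_F_ne i l m hlm := by simp only [twistGen, mul_smul_comm, hg.one_F_ne i l m hlm, smul_zero]
  E_F_same i l := by
    obtain ⟨m, hm⟩ := D.exists_p_sub_d i
    simp only [twistGen, smul_mul_smul_comm, ← zpow_add, hs.map_pi_pow, hs.map_qint, mul_smul,
      ← Units.smul_def]
    rw [smul_comm _ (t ^ _), smul_smul, ← zpow_add, ← hg.E_F_same, smul_sub]
    congr 2
    · congr 1
      rw [h.α_sub, D.phi_self, ← D.two_mul_d]
      linear_combination h.add_eq i l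
    -- The exponents differ by 2dᵢ + 2p(i), and p(i) = dᵢ + 2m. The preceding term needs no
    -- congruence: its exponents are equal.
    · refine zpow_eq_of_sub_eq_four_mul hs.t_four (D.d i + m) ?_
      rw [h.β_add, D.phi_self, D.p_mul_self]
      linear_combination h.add_eq i l + 2 * hm
  E_F_ne i j l hij := by
    obtain ⟨r, hr⟩ := D.exists_phi_sub hij
    simp only [twistGen, smul_mul_smul_comm, ← zpow_add, hs.map_pi_pow, mul_smul,
      ← Units.smul_def]
    rw [smul_comm _ (t ^ _), smul_smul, ← zpow_add]
    have e : t ^ (2 * ((D.p i * D.p j : ℕ) : ℤ) + (β j (l + D.root i) + α i l)) =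
        t ^ (α i (l - D.root j) + β j l) := by
      -- The difference is 2p(i)p(j) + i·j - (φ(i,j) - φ(j,i)); the asymmetry of φ is designed to
      -- make this a multiple of 4.
      refine zpow_eq_of_sub_eq_four_mul hs.t_four (-r) ?_
      rw [h.α_sub, h.β_add]
      push_cast
      linear_combination -hr
    rw [e, ← smul_sub, hg.E_F_ne i j l hij, smul_zero]
  serre_E i j l hij := by
    obtain ⟨m, hm⟩ := D.exists_p_sub_d i
    obtain ⟨r, hr⟩ := D.exists_phi_sub hij
    -- The common factor pulled out is the power of t in the term k = 0; it remains to see that all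
    -- other terms carry the same power.
    rw [← smul_zero (t ^ (D.b i j * (α i l + (D.dot i j - D.phi i j)) +
      D.d i * ((D.b i j).choose 2 : ℕ) + α j l)), ← hg.serre_E i j l hij, Finset.smul_sum]
    refine Finset.sum_congr rfl fun k hk => ?_
    obtain ⟨n, hn⟩ := Nat.exists_eq_add_of_le (Nat.lt_succ_iff.1 (Finset.mem_range.1 hk))
    have hb := D.b_cast hij
    have hd := D.d_mul_a i j
    rw [h.ePow_twistGen, h.ePow_twistGen, twistGen, smul_mul_smul_comm, smul_mul_smul_comm,
      hs.map_serreCoeff, mul_smul, ← Units.smul_def, smul_comm (ψ _), smul_smul, ← zpow_add,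
      ← zpow_add, ← zpow_add]
    congr 1
    -- Relative to k = 0 the exponent grows by 2C(k,2)p(i) + 2k p(i)p(j) + dᵢk(b - k) + k(φ(i,j) -
    -- φ(j,i)), where b = bᵢⱼ. Since dᵢ(1 - b) = i·j, the third summand is -2dᵢC(k,2) - k i·j. The
    -- i·j terms cancel, and what is left is 2C(k,2)(p(i) - dᵢ) + 4k p(i)p(j) + 4kr.
    refine zpow_eq_of_sub_eq_four_mul hs.t_four
      (k * r + k * D.p i * D.p j + (k.choose 2 : ℕ) * m) ?_
    rw [h.α_add, h.α_add_nsmul, h.α_add_nsmul, D.phi_self, ← D.two_mul_d, D.dot_symm j i]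
    rw [hn] at hb ⊢
    rw [Nat.add_sub_cancel_left, choose_two_add]
    push_cast at hb ⊢
    linear_combination k * hr + 2 * (k.choose 2 : ℕ) * hm + D.d i * k * hb - k * hd +
      D.d i * two_mul_choose_two k
  serre_F i j l hij := by
    obtain ⟨m, hm⟩ := D.exists_p_sub_d i
    obtain ⟨r, hr⟩ := D.exists_phi_sub hij
    -- Again the power of t in the term k = 0.
    rw [← smul_zero (t ^ (D.b i j * (β i l - D.phi i j) -
      D.d i * ((D.b i j).choose 2 : ℕ) + β j l)), ← hg.serre_F i j l hij, Finset.smul_sum]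
    refine Finset.sum_congr rfl fun k hk => ?_
    obtain ⟨n, hn⟩ := Nat.exists_eq_add_of_le (Nat.lt_succ_iff.1 (Finset.mem_range.1 hk))
    have hb := D.b_cast hij
    have hd := D.d_mul_a i j
    rw [h.fPow_twistGen, h.fPow_twistGen, twistGen, smul_mul_smul_comm, smul_mul_smul_comm,
      hs.map_serreCoeff, mul_smul, ← Units.smul_def, smul_comm (ψ _), smul_smul, ← zpow_add,
      ← zpow_add, ← zpow_add]
    congr 1
    -- The contributions of the powers of Fᵢ cancel as for E, and the same difference of exponents
    -- is left.
    refine zpow_eq_of_sub_eq_four_mul hs.t_four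
      (k * r + k * D.p i * D.p j + (k.choose 2 : ℕ) * m) ?_
    rw [h.β_sub, h.β_sub_nsmul, h.β_sub_nsmul, D.phi_self]
    rw [hn] at hb ⊢
    rw [Nat.add_sub_cancel_left, choose_two_add]
    push_cast at hb ⊢
    linear_combination k * hr + 2 * (k.choose 2 : ℕ) * hm + D.d i * k * hb - k * hd +
      D.d i * two_mul_choose_two k

end TwistExponents

end Twist

/-! ### The twistor -/

theorem scalarTwist_twistQvtPi :
    ScalarTwist (algebraMap QvPi QvtPi) (twistQvtPi.comp (algebraMap QvPi QvtPi)) tQvtPi where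
  t_sq := tQvtPi_sq
  map_pi := by rw [RingHom.comp_apply, algebraMap_QvPi_pi, twistQvtPi_pi]
  map_v := by
    refine Units.ext ?_
    change twistQvtPi (algebraMap QvPi QvtPi (vQvPi : QvPiˣ)) = (tQvtPi⁻¹ : QvtPiˣ) *
      algebraMap QvPi QvtPi (vQvPi : QvPiˣ)
    rw [algebraMap_QvPi_v, twistQvtPi_v, Units.val_mul]

section Twistor

variable [Fintype I] [LinearOrder I] (D : SuperRootDatum I Y X) (C : Transversal D)

/-- The exponent of `𝐭` in `Ψ̇(E_i 1_λ)`. -/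
def twistExpE (i : I) (l : X) : ℤ := D.d i * D.pairing (D.coroot i) l - dotphi D C i l

theorem twistExponents : TwistExponents D (twistExpE D C) (dotphi D C) where
  add_eq _ _ := sub_add_cancel _ _
  β_add := dotphi_add_root D C

theorem exists_twistorHom : ∃ f : Udott D →ₙ+* Udott D,
    (∀ x, f (Udott.of D x) = twistGen tQvtPi (twistExpE D C) (dotphi D C) (Udott.of D) x) ∧
      ∀ (c : QvtPi) x, f (c • x) = twistQvtPi c • f x :=
  exists_dotLift twistQvtPi ((twistExponents D C).dotSat scalarTwist_twistQvtPi (Udott_of_sat D))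

/-- The twistor as an endomorphism. -/
def twistorHom : Udott D →ₙ+* Udott D := (exists_twistorHom D C).choose

theorem twistorHom_of (x : DotGen I X) : twistorHom D C (Udott.of D x) =
    twistGen tQvtPi (twistExpE D C) (dotphi D C) (Udott.of D) x :=
  (exists_twistorHom D C).choose_spec.1 x

theorem twistorHom_smul (c : QvtPi) (x : Udott D) :
    twistorHom D C (c • x) = twistQvtPi c • twistorHom D C x :=
  (exists_twistorHom D C).choose_spec.2 c x

theorem units_map_twistQvtPi_t : Units.map (twistQvtPi : QvtPi →* QvtPi) tQvtPi = tQvtPi :=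
  Units.ext twistQvtPi_t

theorem twistorHom_tpow_smul (n : ℤ) (x : Udott D) :
    twistorHom D C (tQvtPi ^ n • x) = tQvtPi ^ n • twistorHom D C x := by
  rw [Units.smul_def, twistorHom_smul, ← coe_units_map, map_zpow, units_map_twistQvtPi_t]
  rfl

/-- Since 𝐭 is fixed, each application rescales a generator by the same power 𝐭ⁿ, and 𝐭⁴ⁿ = 1; on
scalars the fourth power is trivial as well. So the cube serves as inverse. -/
theorem twistorHom_comp_four (x : Udott D) :
    twistorHom D C (twistorHom D C (twistorHom D C (twistorHom D C x))) = x := by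
  suffices h : (twistorHom D C).comp ((twistorHom D C).comp
      ((twistorHom D C).comp (twistorHom D C))) = NonUnitalRingHom.id (Udott D) from
    DFunLike.congr_fun h x
  refine Udott_hom_ext (RingHom.id QvtPi) (fun c x => ?_) (fun c x => rfl) fun x => ?_
  · simp only [NonUnitalRingHom.comp_apply, twistorHom_smul]
    exact congrArg (· • _) (RingHom.congr_fun twistQvtPi_comp_four c)
  · have h4 : ∀ n : ℤ, tQvtPi ^ n * (tQvtPi ^ n * (tQvtPi ^ n * tQvtPi ^ n)) = 1 := by
      intro n
      rw [← zpow_add, ← zpow_add, ← zpow_add]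
      exact (zpow_eq_of_sub_eq_four_mul scalarTwist_twistQvtPi.t_four n (by ring)).trans
        (zpow_zero _)
    cases x <;>
    simp only [NonUnitalRingHom.comp_apply, twistorHom_of, twistGen, twistorHom_tpow_smul,
      NonUnitalRingHom.id_apply]
    all_goals simp only [smul_smul, h4, one_smul]

/-- The twistor. -/
def twistor : Udott D ≃+* Udott D where
  toFun := twistorHom D C
  invFun x := twistorHom D C (twistorHom D C (twistorHom D C x))
  left_inv := twistorHom_comp_four D C
  right_inv := twistorHom_comp_four D C
  map_mul' := map_mul _
  map_add' := map_add _

theorem twistor_apply (x : Udott D) : twistor D C x = twistorHom D C x := rfl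

theorem isTwistor_twistor : IsTwistor D C (twistor D C) where
  map_one l := twistorHom_of D C (.one l)
  map_E i l := twistorHom_of D C (.E i l)
  map_F i l := twistorHom_of D C (.F i l)
  map_t_smul x := by rw [twistor_apply, twistorHom_smul, twistQvtPi_t]; rfl
  map_pi_smul x := by rw [twistor_apply, twistorHom_smul, twistQvtPi_pi]; rfl
  map_v_smul x := by rw [twistor_apply, twistorHom_smul, twistQvtPi_v]; rfl

end Twistor

/-! ### Solutions of the relations of the covering quantum group -/

/-- The assignment `g` of values in the `S`-algebra `B` to the generators of the covering
quantum group satisfies the defining relations, where scalars act through `ψ`. -/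
structure USat {S B : Type*} [CommRing S] [Ring B] [Algebra S B] (D : SuperRootDatum I Y X)
    (ψ : QvPi →+* S) (g : Gen I Y → B) : Prop where
  J_add (μ ν : Y) : g (.J μ) * g (.J ν) = g (.J (μ + ν))
  K_add (μ ν : Y) : g (.K μ) * g (.K ν) = g (.K (μ + ν))
  K_zero : g (.K 0) = 1
  J_zero : g (.J 0) = 1
  J_sq (ν : Y) : g (.J ν) ^ 2 = 1
  J_K (μ ν : Y) : g (.J μ) * g (.K ν) = g (.K ν) * g (.J μ)
  J_E (μ : Y) (i : I) : g (.J μ) * g (.E i) =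
    ψ (piU Qv ^ D.pairing μ (D.root i) : QvPiˣ) • (g (.E i) * g (.J μ))
  J_F (μ : Y) (i : I) : g (.J μ) * g (.F i) =
    ψ (piU Qv ^ (-D.pairing μ (D.root i)) : QvPiˣ) • (g (.F i) * g (.J μ))
  K_E (μ : Y) (i : I) : g (.K μ) * g (.E i) =
    ψ (vQvPi ^ D.pairing μ (D.root i) : QvPiˣ) • (g (.E i) * g (.K μ))
  K_F (μ : Y) (i : I) : g (.K μ) * g (.F i) =
    ψ (vQvPi ^ (-D.pairing μ (D.root i)) : QvPiˣ) • (g (.F i) * g (.K μ))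
  E_F_same (i : I) :
    g (.E i) * g (.F i) - ψ ((piU Qv : QvPi) ^ (D.p i * D.p i)) • (g (.F i) * g (.E i)) =
      ψ (Ring.inverse (((pii D.toSuperCartanDatum i * vi D.toSuperCartanDatum i : QvPiˣ) : QvPi) -
          (((vi D.toSuperCartanDatum i)⁻¹ : QvPiˣ) : QvPi))) •
        (g (.J (D.d i • D.coroot i)) * g (.K (D.d i • D.coroot i)) -
          g (.K (-(D.d i • D.coroot i))))
  E_F_ne (i j : I) (h : i ≠ j) :
    g (.E i) * g (.F j) - ψ ((piU Qv : QvPi) ^ (D.p i * D.p j)) • (g (.F j) * g (.E i)) = 0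
  serre_E (i j : I) (h : i ≠ j) :
    ∑ k ∈ Finset.range (D.b i j + 1), ψ (serreCoeff D.toSuperCartanDatum i j k) •
        (g (.E i) ^ (D.b i j - k) * g (.E j) * g (.E i) ^ k) = 0
  serre_F (i j : I) (h : i ≠ j) :
    ∑ k ∈ Finset.range (D.b i j + 1), ψ (serreCoeff D.toSuperCartanDatum i j k) •
        (g (.F i) ^ (D.b i j - k) * g (.F j) * g (.F i) ^ k) = 0

theorem USat.map {S S' B B' : Type*} [CommRing S] [CommRing S'] [Ring B] [Ring B'] [Algebra S B]
    [Algebra S' B'] {D : SuperRootDatum I Y X} {ψ : QvPi →+* S} {g : Gen I Y → B}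
    (h : USat D ψ g) (f : B →+* B') {θ : S →+* S'} (hf : ∀ c b, f (c • b) = θ c • f b) :
    USat D (θ.comp ψ) fun x => f (g x) := by
  constructor <;> intros <;>
    try simp only [RingHom.comp_apply, ← hf, ← map_mul, ← map_pow, ← map_sub, ← map_sum]
  · rw [h.J_add]
  · rw [h.K_add]
  · rw [h.K_zero, map_one]
  · rw [h.J_zero, map_one]
  · rw [h.J_sq, map_one]
  · rw [h.J_K]
  · rw [h.J_E]
  · rw [h.J_F]
  · rw [h.K_E]
  · rw [h.K_F]
  · rw [h.E_F_same]
  · rw [h.E_F_ne _ _ ‹_›, map_zero]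
  · rw [h.serre_E _ _ ‹_›, map_zero]
  · rw [h.serre_F _ _ ‹_›, map_zero]

theorem mkAlgHom_sat (D : SuperRootDatum I Y X) :
    USat D (RingHom.id QvPi) fun x => RingQuot.mkAlgHom QvPi (Rel D) (gen x) := by
  have key : ∀ {x y}, Rel D x y → RingQuot.mkAlgHom QvPi (Rel D) x =
    RingQuot.mkAlgHom QvPi (Rel D) y := fun h => RingQuot.mkAlgHom_rel QvPi h
  constructor <;> intros <;> try simp only [RingHom.id_apply, ← map_smul, ← map_mul, ← map_sub,
    ← map_sum, ← map_pow (RingQuot.mkAlgHom QvPi (Rel D))]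
  · exact key (.J_add _ _)
  · exact key (.K_add _ _)
  · exact (key .K_zero).trans (map_one _)
  · exact (key .J_zero).trans (map_one _)
  · exact (key (.J_sq _)).trans (map_one _)
  · exact key (.J_K _ _)
  · exact key (.J_E _ _)
  · exact key (.J_F _ _)
  · exact key (.K_E _ _)
  · exact key (.K_F _ _)
  · exact key (.E_F_same _)
  · exact (key (.E_F_ne _ _ ‹_›)).trans (map_zero _)
  · exact (key (.serre_E _ _ ‹_›)).trans (map_zero _)
  · exact (key (.serre_F _ _ ‹_›)).trans (map_zero _)

theorem UAt_of_sat (D : SuperRootDatum I Y X) (ε : ℤˣ) : USat D (specQvPi ε) (UAt.of D ε) := by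
  have h1 := (mkAlgHom_sat D).map
    (Algebra.TensorProduct.includeRight : U D →ₐ[QvPi] Ut D).toRingHom
    (θ := algebraMap QvPi QvtPi) (fun c b => by
      change Algebra.TensorProduct.includeRight (c • b) = _
      rw [map_smul, algebraMap_smul]; rfl)
  exact h1.map (Algebra.TensorProduct.includeRight : Ut D →ₐ[QvtPi] UAt D ε).toRingHom
    (θ := algebraMap QvtPi (AtPi ε)) (fun c b => by
      change Algebra.TensorProduct.includeRight (c • b) = _
      rw [map_smul, algebraMap_smul]; rfl)

/-- The universal property of `𝐔[𝐭]|_{π=ε}`. -/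
theorem exists_uLift {B : Type*} [Ring B] {D : SuperRootDatum I Y X} {ε : ℤˣ} [Algebra (AtPi ε) B]
    {g : Gen I Y → B} (h : USat D (specQvPi ε) g) :
    ∃ f : UAt D ε →ₐ[AtPi ε] B, ∀ x, f (UAt.of D ε x) = g x := by
  let _ : Algebra QvtPi B := ((algebraMap (AtPi ε) B).comp (algebraMap QvtPi (AtPi ε))).toAlgebra'
    fun c x => Algebra.commutes (algebraMap QvtPi (AtPi ε) c) x
  let _ : Algebra QvPi B := ((algebraMap (AtPi ε) B).comp (specQvPi ε)).toAlgebra'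
    fun c x => Algebra.commutes (specQvPi ε c) x
  have : IsScalarTower QvtPi (AtPi ε) B := IsScalarTower.of_algebraMap_eq fun _ => rfl
  have : IsScalarTower QvPi QvtPi B := IsScalarTower.of_algebraMap_eq fun _ => rfl
  have hsmul : ∀ (c : QvPi) (b : B), c • b = specQvPi ε c • b := fun c b => by
    rw [Algebra.smul_def, Algebra.smul_def]; rfl
  have hgen : ∀ x, FreeAlgebra.lift QvPi g (gen x) = g x := fun x => FreeAlgebra.lift_ι_apply g x
  have hrel : ∀ ⦃x y⦄, Rel D x y → FreeAlgebra.lift QvPi g x = FreeAlgebra.lift QvPi g y := by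
    intro x y hxy
    cases hxy <;>
    simp only [map_mul, map_sub, map_sum, map_zero, map_one, map_smul, hgen, hsmul,
      map_pow (FreeAlgebra.lift QvPi g)]
    · exact h.J_add _ _
    · exact h.K_add _ _
    · exact h.K_zero
    · exact h.J_zero
    · exact h.J_sq _
    · exact h.J_K _ _
    · exact h.J_E _ _
    · exact h.J_F _ _
    · exact h.K_E _ _
    · exact h.K_F _ _
    · exact h.E_F_same _
    · exact h.E_F_ne _ _ ‹_›
    · exact h.serre_E _ _ ‹_›
    · exact h.serre_F _ _ ‹_›
  let f₀ : U D →ₐ[QvPi] B := RingQuot.liftAlgHom QvPi ⟨FreeAlgebra.lift QvPi g, hrel⟩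
  have hc₀ : ∀ c x, Commute (Algebra.ofId QvtPi B c) (f₀ x) :=
    fun c x => Algebra.commutes c (f₀ x)
  let f₁ : Ut D →ₐ[QvtPi] B := Algebra.TensorProduct.lift (Algebra.ofId QvtPi B) f₀ hc₀
  have hc₁ : ∀ c x, Commute (Algebra.ofId (AtPi ε) B c) (f₁ x) :=
    fun c x => Algebra.commutes c (f₁ x)
  refine ⟨Algebra.TensorProduct.lift (Algebra.ofId (AtPi ε) B) f₁
    hc₁, fun x => ?_⟩
  refine (Algebra.TensorProduct.lift_tmul _ _ hc₁ _ _).trans ?_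
  rw [map_one, one_mul]
  refine (Algebra.TensorProduct.lift_tmul _ _ hc₀ _ _).trans ?_
  rw [map_one, one_mul]
  exact (RingQuot.liftAlgHom_mkAlgHom_apply QvPi _ hrel (gen x)).trans (hgen x)

/-! ### Weight decompositions -/

section WeightProj

variable {X S M : Type*} [CommRing S] [AddCommGroup M] [Module S M]

/-- The maps `P λ` are the projections for a direct sum decomposition `M = ⨁ λ, W λ`. -/
structure WeightProj (W : X → Submodule S M) (P : X → Module.End S M) : Prop where
  mem (l : X) (m : M) : P l m ∈ W l
  same {l : X} {m : M} (h : m ∈ W l) : P l m = m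
  ne {l k : X} (h : l ≠ k) {m : M} (hm : m ∈ W k) : P l m = 0
  finite (m : M) : (Function.support fun l => P l m).Finite
  sum (m : M) : ∑ᶠ l, P l m = m

namespace WeightProj

variable {W : X → Submodule S M} {P : X → Module.End S M} (h : WeightProj W P)
include h

theorem hom_ext {N : Type*} [AddCommMonoid N] {f g : M →+ N}
    (hfg : ∀ l, ∀ m ∈ W l, f m = g m) : f = g := by
  ext m
  rw [← h.sum m, AddMonoidHom.map_finsum f (h.finite m), AddMonoidHom.map_finsum g (h.finite m)]
  exact finsum_congr fun l => hfg l _ (h.mem l m)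

theorem end_ext {f g : Module.End S M} (hfg : ∀ l, ∀ m ∈ W l, f m = g m) : f = g :=
  LinearMap.toAddMonoidHom_injective (h.hom_ext hfg)

theorem iSup_eq_top : ⨆ l, W l = ⊤ := by
  rw [eq_top_iff]
  intro m _
  rw [← h.sum m, finsum_eq_sum _ (h.finite m)]
  exact Submodule.sum_mem _ fun l _ => Submodule.mem_iSup_of_mem l (h.mem l m)

theorem iSupIndep : iSupIndep W := by
  intro l
  rw [Submodule.disjoint_def]
  intro m hm hm'
  have hle : ⨆ k, ⨆ (_ : k ≠ l), W k ≤ LinearMap.ker (P l) :=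
    iSup₂_le fun k hk x hx => h.ne hk.symm hx
  rw [← h.same hm]
  exact hle hm'

/-- The endomorphism that is `f λ` on `W λ`. -/
def glue (f : X → Module.End S M) : Module.End S M where
  toFun m := ∑ᶠ l, f l (P l m)
  map_add' m n := by
    simp only [map_add]
    exact finsum_add_distrib ((h.finite m).subset fun l hl h0 => hl (by simp [h0]))
      ((h.finite n).subset fun l hl h0 => hl (by simp [h0]))
  map_smul' c m := by
    simp only [map_smul, RingHom.id_apply]
    exact (smul_finsum' c ((h.finite m).subset fun l hl h0 => hl (by simp [h0]))).symm

theorem glue_apply (f : X → Module.End S M) {l : X} {m : M} (hm : m ∈ W l) :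
    h.glue f m = f l m := by
  change ∑ᶠ k, f k (P k m) = f l m
  rw [finsum_eq_single _ l fun k hk => by rw [h.ne hk hm, map_zero], h.same hm]

end WeightProj

theorem exists_weightProj {W : X → Submodule S M} (h : iSupIndep W) (h' : ⨆ l, W l = ⊤) :
    ∃ P : X → Module.End S M, WeightProj W P := by
  classical
  let _ : DirectSum.Decomposition W :=
    (DirectSum.isInternal_submodule_of_iSupIndep_of_iSup_eq_top h h').chooseDecomposition
  have hfin : ∀ m, (Function.support fun l => ((DirectSum.decompose W m l : W l) : M)).Finite := by
    intro m
    refine (DFinsupp.support (DirectSum.decompose W m)).finite_toSet.subset fun l hl => ?_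
    rw [Finset.mem_coe, DFinsupp.mem_support_iff]
    intro h0
    exact hl (by simp only [h0]; rfl)
  refine ⟨fun l => (W l).subtype ∘ₗ DirectSum.component S X (fun l => W l) l ∘ₗ
    (DirectSum.decomposeLinearEquiv W).toLinearMap, ?_, ?_, ?_, hfin, ?_⟩
  · intro l m
    exact ((DirectSum.decompose W m) l).2
  · intro l m hm
    exact DirectSum.decompose_of_mem_same W hm
  · intro l k hlk m hm
    exact DirectSum.decompose_of_mem_ne W hm hlk.symm
  · intro m
    refine Eq.trans ?_ (DirectSum.sum_support_decompose W m)
    refine finsum_eq_sum_of_support_subset _ fun l hl => ?_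
    rw [Finset.mem_coe, DFinsupp.mem_support_iff]
    intro h0
    refine hl ?_
    change ((DirectSum.decompose W m l : W l) : M) = 0
    rw [h0]; rfl

end WeightProj

/-! ### Weight representations -/

section WeightRep

variable {S M : Type*} [CommRing S] [AddCommGroup M] [Module S M]

/-- Operators `e i` and `f i` on a weight module satisfy the relations of the covering quantum
group. -/
structure WeightRep (D : SuperRootDatum I Y X) (ψ : QvPi →+* S) (W : X → Submodule S M)
    (e f : I → Module.End S M) : Prop where
  e_mem (i : I) {l : X} {m : M} (h : m ∈ W l) : e i m ∈ W (l + D.root i)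
  f_mem (i : I) {l : X} {m : M} (h : m ∈ W l) : f i m ∈ W (l - D.root i)
  e_f_same (i : I) {l : X} {m : M} (h : m ∈ W l) :
    e i (f i m) - ψ ((piU Qv : QvPi) ^ (D.p i * D.p i)) • f i (e i m) =
      ψ (qint (vi D.toSuperCartanDatum i) (pii D.toSuperCartanDatum i)
        (D.pairing (D.coroot i) l)) • m
  e_f_ne (i j : I) (hij : i ≠ j) {l : X} {m : M} (h : m ∈ W l) :
    e i (f j m) - ψ ((piU Qv : QvPi) ^ (D.p i * D.p j)) • f j (e i m) = 0
  serre_e (i j : I) (h : i ≠ j) :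
    ∑ k ∈ Finset.range (D.b i j + 1), ψ (serreCoeff D.toSuperCartanDatum i j k) •
        (e i ^ (D.b i j - k) * e j * e i ^ k) = 0
  serre_f (i j : I) (h : i ≠ j) :
    ∑ k ∈ Finset.range (D.b i j + 1), ψ (serreCoeff D.toSuperCartanDatum i j k) •
        (f i ^ (D.b i j - k) * f j * f i ^ k) = 0

/-- The operators by which the generators of the modified covering quantum group act. -/
def dotOp (P : X → Module.End S M) (e f : I → Module.End S M) : DotGen I X → Module.End S M
  | .one l => P l
  | .E i l => e i * P l
  | .F i l => f i * P l

namespace WeightRep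

variable {D : SuperRootDatum I Y X} {ψ : QvPi →+* S} {W : X → Submodule S M}
  {e f : I → Module.End S M} (h : WeightRep D ψ W e f) {P : X → Module.End S M}
  (hP : WeightProj W P)

include h

theorem e_pow_mem (i : I) (n : ℕ) {l : X} {m : M} (hm : m ∈ W l) :
    (e i ^ n) m ∈ W (l + n • D.root i) := by
  induction n with
  | zero => simpa using hm
  | succ n ih =>
    rw [pow_succ', succ_nsmul, ← add_assoc]
    exact h.e_mem i ih

theorem f_pow_mem (i : I) (n : ℕ) {l : X} {m : M} (hm : m ∈ W l) :
    (f i ^ n) m ∈ W (l - n • D.root i) := by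
  induction n with
  | zero => simpa using hm
  | succ n ih =>
    rw [pow_succ', succ_nsmul, ← sub_sub]
    exact h.f_mem i ih

include hP

/-- All projections but the rightmost are redundant, because each power of eᵢ carries W λ into a
single weight space. -/
theorem ePow_dotOp (i : I) (n : ℕ) (l : X) : ePow D (dotOp P e f) i n l = e i ^ n * P l := by
  induction n with
  | zero => simp [ePow, dotOp]
  | succ n ih =>
    rw [ePow, ih, dotOp, pow_succ']
    refine LinearMap.ext fun m => ?_
    exact congrArg (e i) (hP.same (h.e_pow_mem i n (hP.mem l m)))

theorem fPow_dotOp (i : I) (n : ℕ) (l : X) : fPow D (dotOp P e f) i n l = f i ^ n * P l := by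
  induction n with
  | zero => simp [fPow, dotOp]
  | succ n ih =>
    rw [fPow, ih, dotOp, pow_succ']
    refine LinearMap.ext fun m => ?_
    exact congrArg (f i) (hP.same (h.f_pow_mem i n (hP.mem l m)))

/-- A weight representation gives a solution of the relations of the modified algebra. -/
theorem dotSat : DotSat D ψ (dotOp P e f) where
  one_one l := LinearMap.ext fun m => hP.same (hP.mem l m)
  one_one_ne l k hlk := LinearMap.ext fun m => hP.ne hlk (hP.mem k m)
  E_one i l := LinearMap.ext fun m => congrArg (e i) (hP.same (hP.mem l m))
  E_one_ne i l k hlk := LinearMap.ext fun m =>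
    (congrArg (e i) (hP.ne hlk (hP.mem k m))).trans (map_zero _)
  one_E i l := LinearMap.ext fun m => hP.same (h.e_mem i (hP.mem l m))
  one_E_ne i l k hlk := LinearMap.ext fun m => hP.ne hlk (h.e_mem i (hP.mem l m))
  F_one i l := LinearMap.ext fun m => congrArg (f i) (hP.same (hP.mem l m))
  F_one_ne i l k hlk := LinearMap.ext fun m =>
    (congrArg (f i) (hP.ne hlk (hP.mem k m))).trans (map_zero _)
  one_F i l := LinearMap.ext fun m => hP.same (h.f_mem i (hP.mem l m))
  one_F_ne i l k hlk := LinearMap.ext fun m => hP.ne hlk (h.f_mem i (hP.mem l m))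
  E_F_same i l := LinearMap.ext fun m => by
    have hm := hP.mem l m
    simp only [dotOp, LinearMap.sub_apply, LinearMap.smul_apply, Module.End.mul_apply]
    rw [hP.same (h.f_mem i hm), hP.same (h.e_mem i hm), h.e_f_same i hm]
  E_F_ne i j l hij := LinearMap.ext fun m => by
    have hm := hP.mem l m
    simp only [dotOp, LinearMap.sub_apply, LinearMap.smul_apply, Module.End.mul_apply]
    rw [hP.same (h.f_mem j hm), hP.same (h.e_mem i hm), h.e_f_ne i j hij hm]; rfl
  serre_E i j l hij := by
    have key : ∀ k, ePow D (dotOp P e f) i (D.b i j - k) (l + k • D.root i + D.root j) *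
        dotOp P e f (.E j (l + k • D.root i)) * ePow D (dotOp P e f) i k l =
        (e i ^ (D.b i j - k) * e j * e i ^ k) * P l := by
      intro k
      rw [h.ePow_dotOp hP, h.ePow_dotOp hP, dotOp]
      refine LinearMap.ext fun m => ?_
      have hk := h.e_pow_mem i k (hP.mem l m)
      simp only [Module.End.mul_apply]
      rw [hP.same hk, hP.same (h.e_mem j hk)]
    simp only [key]
    rw [← zero_mul (P l), ← h.serre_e i j hij, Finset.sum_mul]
    exact Finset.sum_congr rfl fun k _ => (smul_mul_assoc _ _ _).symm
  serre_F i j l hij := by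
    have key : ∀ k, fPow D (dotOp P e f) i (D.b i j - k) (l - k • D.root i - D.root j) *
        dotOp P e f (.F j (l - k • D.root i)) * fPow D (dotOp P e f) i k l =
        (f i ^ (D.b i j - k) * f j * f i ^ k) * P l := by
      intro k
      rw [h.fPow_dotOp hP, h.fPow_dotOp hP, dotOp]
      refine LinearMap.ext fun m => ?_
      have hk := h.f_pow_mem i k (hP.mem l m)
      simp only [Module.End.mul_apply]
      rw [hP.same hk, hP.same (h.f_mem j hk)]
    simp only [key]
    rw [← zero_mul (P l), ← h.serre_f i j hij, Finset.sum_mul]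
    exact Finset.sum_congr rfl fun k _ => (smul_mul_assoc _ _ _).symm

end WeightRep

/-- A solution of the relations of the modified algebra gives a weight representation. -/
theorem DotSat.weightRep {D : SuperRootDatum I Y X} {ψ : QvPi →+* S}
    {g : DotGen I X → Module.End S M} (hg : DotSat D ψ g) {W : X → Submodule S M}
    (hP : WeightProj W fun l => g (.one l)) :
    WeightRep D ψ W (fun i => hP.glue fun l => g (.E i l)) fun i => hP.glue fun l => g (.F i l) := by
  have he : ∀ i {l m}, m ∈ W l → hP.glue (fun l => g (.E i l)) m = g (.E i l) m :=
    fun i _ _ hm => hP.glue_apply _ hm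
  have hf : ∀ i {l m}, m ∈ W l → hP.glue (fun l => g (.F i l)) m = g (.F i l) m :=
    fun i _ _ hm => hP.glue_apply _ hm
  have hE : ∀ i l m, g (.E i l) m ∈ W (l + D.root i) := fun i l m => by
    rw [← hg.one_E]; exact hP.mem _ _
  have hF : ∀ i l m, g (.F i l) m ∈ W (l - D.root i) := fun i l m => by
    rw [← hg.one_F]; exact hP.mem _ _
  -- Both claims go through one induction: the glued operator can be evaluated on the next vector
  -- only once its weight is known.
  have hEn : ∀ i n {l m}, m ∈ W l →
      (hP.glue (fun l => g (.E i l)) ^ n) m = ePow D g i n l m ∧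
        ePow D g i n l m ∈ W (l + n • D.root i) := by
    intro i n l m hm
    induction n with
    | zero => exact ⟨(hP.same hm).symm, by rw [zero_nsmul, add_zero]; exact hP.mem l m⟩
    | succ n ih =>
      rw [pow_succ', Module.End.mul_apply, ih.1, he i ih.2, succ_nsmul, ← add_assoc]
      exact ⟨rfl, hE _ _ _⟩
  have hFn : ∀ i n {l m}, m ∈ W l →
      (hP.glue (fun l => g (.F i l)) ^ n) m = fPow D g i n l m ∧
        fPow D g i n l m ∈ W (l - n • D.root i) := by
    intro i n l m hm
    induction n with
    | zero => exact ⟨(hP.same hm).symm, by rw [zero_nsmul, sub_zero]; exact hP.mem l m⟩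
    | succ n ih =>
      rw [pow_succ', Module.End.mul_apply, ih.1, hf i ih.2, succ_nsmul, ← sub_sub]
      exact ⟨rfl, hF _ _ _⟩
  constructor
  · intro i l m hm
    rw [he i hm]; exact hE i l m
  · intro i l m hm
    rw [hf i hm]; exact hF i l m
  · intro i l m hm
    rw [hf i hm, he i hm, he i (hF i l m), hf i (hE i l m)]
    have := LinearMap.congr_fun (hg.E_F_same i l) m
    simp only [LinearMap.sub_apply, LinearMap.smul_apply, Module.End.mul_apply, hP.same hm] at this
    exact this
  · intro i j hij l m hm
    rw [hf j hm, he i hm, he i (hF j l m), hf j (hE i l m)]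
    exact LinearMap.congr_fun (hg.E_F_ne i j l hij) m
  · intro i j hij
    refine hP.end_ext fun l m hm => ?_
    rw [← hg.serre_E i j l hij]
    simp only [LinearMap.sum_apply, LinearMap.smul_apply, Module.End.mul_apply]
    refine Finset.sum_congr rfl fun k _ => ?_
    obtain ⟨h1, h2⟩ := hEn i k hm
    rw [h1, he j h2, (hEn i _ (hE j _ _)).1]
  · intro i j hij
    refine hP.end_ext fun l m hm => ?_
    rw [← hg.serre_F i j l hij]
    simp only [LinearMap.sum_apply, LinearMap.smul_apply, Module.End.mul_apply]
    refine Finset.sum_congr rfl fun k _ => ?_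
    obtain ⟨h1, h2⟩ := hFn i k hm
    rw [h1, hf j h2, (hFn i _ (hF j _ _)).1]

/-- The operators by which the generators of the covering quantum group act. -/
def uOp (D : SuperRootDatum I Y X) (ψ : QvPi →+* S) {W : X → Submodule S M}
    {P : X → Module.End S M} (hP : WeightProj W P) (e f : I → Module.End S M) :
    Gen I Y → Module.End S M
  | .E i => e i
  | .F i => f i
  | .K μ => hP.glue fun l => ψ (vQvPi ^ D.pairing μ l : QvPiˣ) • 1
  | .J μ => hP.glue fun l => ψ (piU Qv ^ D.pairing μ l : QvPiˣ) • 1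

/-- The right side is the eigenvalue of (J_{dᵢi}K_{dᵢi} - K_{-dᵢi})/(πᵢvᵢ - vᵢ⁻¹) on a weight with
⟨i,λ⟩ = n. This identifies the EF-relation of 𝐔 with that of 𝐔̇ on each weight space, in both
directions. -/
theorem qint_vi_pii (D : SuperCartanDatum I) (i : I) (n : ℤ) :
    qint (vi D i) (pii D i) n =
      Ring.inverse (((pii D i * vi D i : QvPiˣ) : QvPi) - (((vi D i)⁻¹ : QvPiˣ) : QvPi)) *
        (((piU Qv ^ (D.d i * n) : QvPiˣ) : QvPi) * (vQvPi ^ (D.d i * n) : QvPiˣ) -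
          (vQvPi ^ (-(D.d i * n)) : QvPiˣ)) := by
  rw [qint, mul_comm, ← Units.val_mul, ← mul_zpow, zpow_mul, zpow_natCast, mul_pow, ← mul_neg,
    zpow_mul vQvPi, zpow_natCast]
  rfl

/-- On a weight space K and J are scalars, so the relations involving them become additivity of
exponents, with π² = 1 needed for J² = 1. The rest is part of the weight representation, up to
`qint_vi_pii`. -/
theorem WeightRep.uSat {D : SuperRootDatum I Y X} {ψ : QvPi →+* S} {W : X → Submodule S M}
    {e f : I → Module.End S M} (h : WeightRep D ψ W e f) {P : X → Module.End S M}
    (hP : WeightProj W P) : USat D ψ (uOp D ψ hP e f) := by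
  have hK : ∀ μ {l m}, m ∈ W l →
      uOp D ψ hP e f (.K μ) m = ψ (vQvPi ^ D.pairing μ l : QvPiˣ) • m :=
    fun μ _ _ hm => hP.glue_apply _ hm
  have hJ : ∀ μ {l m}, m ∈ W l →
      uOp D ψ hP e f (.J μ) m = ψ (piU Qv ^ D.pairing μ l : QvPiˣ) • m :=
    fun μ _ _ hm => hP.glue_apply _ hm
  have hE : ∀ i {l m}, m ∈ W l → uOp D ψ hP e f (.E i) m ∈ W (l + D.root i) :=
    fun i _ _ hm => h.e_mem i hm
  have hF : ∀ i {l m}, m ∈ W l → uOp D ψ hP e f (.F i) m ∈ W (l - D.root i) :=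
    fun i _ _ hm => h.f_mem i hm
  have hpi : piU Qv ^ 2 = 1 := Units.ext (by simpa [piU] using root_pi_sq Qv)
  constructor
  · intro μ ν
    refine hP.end_ext fun l m hm => ?_
    rw [Module.End.mul_apply, hJ ν hm, map_smul, hJ μ hm, hJ _ hm, smul_smul, ← map_mul,
      ← Units.val_mul, ← zpow_add, map_add, LinearMap.add_apply, add_comm]
  · intro μ ν
    refine hP.end_ext fun l m hm => ?_
    rw [Module.End.mul_apply, hK ν hm, map_smul, hK μ hm, hK _ hm, smul_smul, ← map_mul,
      ← Units.val_mul, ← zpow_add, map_add, LinearMap.add_apply, add_comm]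
  · refine hP.end_ext fun l m hm => ?_
    rw [hK 0 hm]; simp
  · refine hP.end_ext fun l m hm => ?_
    rw [hJ 0 hm]; simp
  · intro μ
    refine hP.end_ext fun l m hm => ?_
    rw [pow_two, Module.End.mul_apply, hJ μ hm, map_smul, hJ μ hm, smul_smul, ← map_mul,
      ← Units.val_mul, ← mul_zpow, ← pow_two, hpi]
    simp
  · intro μ ν
    refine hP.end_ext fun l m hm => ?_
    rw [Module.End.mul_apply, Module.End.mul_apply, hJ μ hm, hK ν hm, map_smul, map_smul, hJ μ hm,
      hK ν hm, smul_comm]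
  · intro μ i
    refine hP.end_ext fun l m hm => ?_
    rw [LinearMap.smul_apply, Module.End.mul_apply, Module.End.mul_apply, hJ μ hm, map_smul,
      hJ μ (hE i hm), smul_smul, ← map_mul, ← Units.val_mul,
      ← zpow_add, map_add, add_comm]
  · intro μ i
    refine hP.end_ext fun l m hm => ?_
    rw [LinearMap.smul_apply, Module.End.mul_apply, Module.End.mul_apply, hJ μ hm, map_smul,
      hJ μ (hF i hm), smul_smul, ← map_mul, ← Units.val_mul,
      ← zpow_add, map_sub, neg_add_eq_sub]
  · intro μ i
    refine hP.end_ext fun l m hm => ?_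
    rw [LinearMap.smul_apply, Module.End.mul_apply, Module.End.mul_apply, hK μ hm, map_smul,
      hK μ (hE i hm), smul_smul, ← map_mul, ← Units.val_mul,
      ← zpow_add, map_add, add_comm]
  · intro μ i
    refine hP.end_ext fun l m hm => ?_
    rw [LinearMap.smul_apply, Module.End.mul_apply, Module.End.mul_apply, hK μ hm, map_smul,
      hK μ (hF i hm), smul_smul, ← map_mul, ← Units.val_mul,
      ← zpow_add, map_sub, neg_add_eq_sub]
  · intro i
    refine hP.end_ext fun l m hm => ?_
    refine (h.e_f_same i hm).trans ?_
    rw [LinearMap.smul_apply, LinearMap.sub_apply, Module.End.mul_apply, hK _ hm, map_smul,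
      hJ _ hm, hK _ hm, smul_smul, ← map_mul, ← sub_smul, ← map_sub, smul_smul, ← map_mul,
      qint_vi_pii, map_nsmul, map_neg, map_nsmul, LinearMap.neg_apply, LinearMap.smul_apply,
      nsmul_eq_mul, mul_comm (piU Qv ^ _ : QvPiˣ).val]
  · intro i j hij
    exact hP.end_ext fun l m hm => h.e_f_ne i j hij hm
  · exact h.serre_e
  · exact h.serre_f

end WeightRep

/-! ### The action of the modified algebra on weight modules -/

/-- The algebra is a quotient of a free algebra, base-changed twice. Each base change adds only
scalars, and those of ℚ(v,𝐭)^π can be moved across the outer tensor sign into ℚ(v,𝐭). -/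
theorem UAt_induction {D : SuperRootDatum I Y X} {ε : ℤˣ} {p : UAt D ε → Prop}
    (of : ∀ x, p (UAt.of D ε x)) (scalar : ∀ c : AtPi ε, p (c • (1 : UAt D ε)))
    (add : ∀ x y, p x → p y → p (x + y)) (mul : ∀ x y, p x → p y → p (x * y))
    (x : UAt D ε) : p x := by
  have zero : p 0 := by have := scalar 0; rwa [zero_smul] at this
  have scalar' : ∀ c : QvtPi, p ((1 : AtPi ε) ⊗ₜ[QvtPi] (c ⊗ₜ[QvPi] (1 : U D))) := by
    intro c
    have h : (c ⊗ₜ[QvPi] (1 : U D) : Ut D) = c • (1 ⊗ₜ[QvPi] 1) := by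
      rw [TensorProduct.smul_tmul', smul_eq_mul, mul_one]
    have h' := scalar (c • 1)
    rwa [Algebra.TensorProduct.one_def, TensorProduct.smul_tmul', smul_eq_mul, mul_one,
      TensorProduct.smul_tmul, Algebra.TensorProduct.one_def, ← h] at h'
  have key : ∀ u : U D, p ((1 : AtPi ε) ⊗ₜ[QvtPi] ((1 : QvtPi) ⊗ₜ[QvPi] u)) := by
    intro u
    obtain ⟨a, rfl⟩ := RingQuot.mkAlgHom_surjective QvPi (Rel D) u
    induction a using FreeAlgebra.induction with
    | grade0 r =>
      have h : ((1 : QvtPi) ⊗ₜ[QvPi] RingQuot.mkAlgHom QvPi (Rel D)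
          (algebraMap QvPi (FreeAlgebra QvPi (Gen I Y)) r) : Ut D) =
          (algebraMap QvPi QvtPi r) ⊗ₜ[QvPi] 1 := by
        rw [AlgHom.commutes, Algebra.algebraMap_eq_smul_one, Algebra.algebraMap_eq_smul_one,
          TensorProduct.smul_tmul]
      rw [h]
      exact scalar' _
    | grade1 x => exact of x
    | mul a b ha hb =>
      have := mul _ _ ha hb
      rwa [Algebra.TensorProduct.tmul_mul_tmul, Algebra.TensorProduct.tmul_mul_tmul, mul_one,
        mul_one, ← map_mul] at this
    | add a b ha hb =>
      have := add _ _ ha hb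
      rwa [← TensorProduct.tmul_add, ← TensorProduct.tmul_add, ← map_add] at this
  have key' : ∀ u : Ut D, p ((1 : AtPi ε) ⊗ₜ[QvtPi] u) := by
    intro u
    induction u using TensorProduct.induction_on with
    | zero => rw [TensorProduct.tmul_zero]; exact zero
    | tmul c u =>
      have := mul _ _ (scalar' c) (key u)
      rwa [Algebra.TensorProduct.tmul_mul_tmul, Algebra.TensorProduct.tmul_mul_tmul, mul_one,
        mul_one, one_mul] at this
    | add a b ha hb => rw [TensorProduct.tmul_add]; exact add _ _ ha hb
  induction x using TensorProduct.induction_on with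
  | zero => exact zero
  | tmul c u =>
    have := mul _ _ (scalar c) (key' u)
    rwa [Algebra.TensorProduct.one_def, TensorProduct.smul_tmul', smul_eq_mul, mul_one,
      Algebra.TensorProduct.tmul_mul_tmul, mul_one, one_mul] at this
  | add a b ha hb => exact add _ _ ha hb

/-- Converse of `WeightRep.uSat`: the commutation rules with K and J make E and F shift simultaneous
eigenspaces by a root. -/
theorem USat.weightRep {S M : Type*} [CommRing S] [AddCommGroup M] [Module S M]
    {D : SuperRootDatum I Y X} {ψ : QvPi →+* S} {g : Gen I Y → Module.End S M} (h : USat D ψ g)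
    {W : X → Submodule S M} (hW : ∀ l m, m ∈ W l ↔ ∀ ν : Y,
      g (.K ν) m = ψ (vQvPi ^ D.pairing ν l : QvPiˣ) • m ∧
      g (.J ν) m = ψ (piU Qv ^ D.pairing ν l : QvPiˣ) • m) :
    WeightRep D ψ W (fun i => g (.E i)) fun i => g (.F i) := by
  have hK : ∀ ν {l : X} {m : M}, m ∈ W l → g (.K ν) m = ψ (vQvPi ^ D.pairing ν l : QvPiˣ) • m :=
    fun ν _ _ hm => ((hW _ _).1 hm ν).1
  have hJ : ∀ ν {l : X} {m : M}, m ∈ W l → g (.J ν) m = ψ (piU Qv ^ D.pairing ν l : QvPiˣ) • m :=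
    fun ν _ _ hm => ((hW _ _).1 hm ν).2
  constructor
  · intro i l m hm
    refine (hW _ _).2 fun ν => ⟨?_, ?_⟩
    · refine (LinearMap.congr_fun (h.K_E ν i) m).trans ?_
      rw [LinearMap.smul_apply, Module.End.mul_apply, hK ν hm, map_smul, smul_smul, ← map_mul,
        ← Units.val_mul, ← zpow_add, map_add, add_comm]
    · refine (LinearMap.congr_fun (h.J_E ν i) m).trans ?_
      rw [LinearMap.smul_apply, Module.End.mul_apply, hJ ν hm, map_smul, smul_smul, ← map_mul,
        ← Units.val_mul, ← zpow_add, map_add, add_comm]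
  · intro i l m hm
    refine (hW _ _).2 fun ν => ⟨?_, ?_⟩
    · refine (LinearMap.congr_fun (h.K_F ν i) m).trans ?_
      rw [LinearMap.smul_apply, Module.End.mul_apply, hK ν hm, map_smul, smul_smul, ← map_mul,
        ← Units.val_mul, ← zpow_add, map_sub, neg_add_eq_sub]
    · refine (LinearMap.congr_fun (h.J_F ν i) m).trans ?_
      rw [LinearMap.smul_apply, Module.End.mul_apply, hJ ν hm, map_smul, smul_smul, ← map_mul,
        ← Units.val_mul, ← zpow_add, map_sub, neg_add_eq_sub]
  · intro i l m hm
    refine (LinearMap.congr_fun (h.E_F_same i) m).trans ?_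
    rw [LinearMap.smul_apply, LinearMap.sub_apply, Module.End.mul_apply, hK _ hm, map_smul,
      hJ _ hm, hK _ hm, smul_smul, ← map_mul, ← sub_smul, ← map_sub, smul_smul, ← map_mul,
      qint_vi_pii, map_nsmul, map_neg, map_nsmul, LinearMap.neg_apply, LinearMap.smul_apply,
      nsmul_eq_mul, mul_comm (piU Qv ^ _ : QvPiˣ).val]
  · intro i j hij l m _
    exact LinearMap.congr_fun (h.E_F_ne i j hij) m
  · exact h.serre_E
  · exact h.serre_F

theorem specQvPi_v_zpow (ε : ℤˣ) (n : ℤ) :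
    specQvPi ε (vQvPi ^ n : QvPiˣ) = ((vAt ε ^ n : (AtPi ε)ˣ) : AtPi ε) := by
  have h : Units.map (specQvPi ε : QvPi →* AtPi ε) vQvPi = vAt ε := Units.ext (specQvPi_v ε)
  rw [← coe_units_map, map_zpow, h]

theorem specQvPi_pi_zpow (ε : ℤˣ) (n : ℤ) :
    specQvPi ε (piU Qv ^ n : QvPiˣ) = (((ε ^ n : ℤˣ) : ℤ) : AtPi ε) := by
  have h : Units.map (specQvPi ε : QvPi →* AtPi ε) (piU Qv) =
    Units.map (Int.castRingHom (AtPi ε) : ℤ →* AtPi ε) ε := Units.ext (specQvPi_pi ε)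
  rw [← coe_units_map, map_zpow, h, ← map_zpow]
  rfl

/-! ### Weight modules, uniqueness of the action, and morphisms -/

section ModuleCat

variable {D : SuperRootDatum I Y X} {ε : ℤˣ} (M : ModuleCat.{w} (UAt D ε))

theorem mem_weightSpace_iff {M : ModuleCat.{w} (UAt D ε)} {l : X} {m : M} :
    m ∈ weightSpace M l ↔ ∀ ν : Y,
      UAt.of D ε (.K ν) • m = specQvPi ε (vQvPi ^ D.pairing ν l : QvPiˣ) • m ∧
      UAt.of D ε (.J ν) • m = specQvPi ε (piU Qv ^ D.pairing ν l : QvPiˣ) • m := by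
  simp only [specQvPi_v_zpow, specQvPi_pi_zpow, Int.cast_smul_eq_zsmul]
  rfl

/-- The operator on a module given by an element of the algebra. -/
def opHom : UAt D ε →ₐ[AtPi ε] Module.End (AtPi ε) M := Algebra.lsmul (AtPi ε) (AtPi ε) M

theorem op_uSat : USat D (specQvPi ε) fun x => opHom M (UAt.of D ε x) :=
  (UAt_of_sat D ε).map (opHom M).toRingHom (θ := RingHom.id _)
    fun c b => map_smul (opHom M) c b

theorem weightRep_op : WeightRep D (specQvPi ε) (weightSpace M)
    (fun i => opHom M (UAt.of D ε (.E i))) fun i => opHom M (UAt.of D ε (.F i)) :=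
  (op_uSat M).weightRep fun _ _ => mem_weightSpace_iff

variable {M}

theorem exists_dotAction (hM : IsWeightModule M) : Nonempty (DotAction M) := by
  obtain ⟨P, hP⟩ := exists_weightProj hM.1 hM.2
  obtain ⟨f, hf, hfs⟩ :=
    exists_dotLift (algebraMap QvtPi (AtPi ε)) ((weightRep_op M).dotSat hP)
  refine ⟨⟨f, hfs, fun l m hm => ?_, fun l k hlk m hm => ?_, fun i l m hm => ?_,
    fun i l m hm => ?_⟩⟩
  · rw [hf]; exact hP.same hm
  · rw [hf]; exact hP.ne hlk hm
  · rw [hf]; exact congrArg (opHom M (UAt.of D ε (.E i))) (hP.same hm)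
  · rw [hf]; exact congrArg (opHom M (UAt.of D ε (.F i))) (hP.same hm)

theorem K_smul {l : X} {m : M} (hm : m ∈ weightSpace M l) (ν : Y) :
    UAt.of D ε (.K ν) • m = ((vAt ε ^ D.pairing ν l : (AtPi ε)ˣ) : AtPi ε) • m := (hm ν).1

theorem J_smul {l : X} {m : M} (hm : m ∈ weightSpace M l) (ν : Y) :
    UAt.of D ε (.J ν) • m = ((ε ^ D.pairing ν l : ℤˣ) : ℤ) • m := (hm ν).2

namespace DotAction

variable {N : ModuleCat.{w} (UAt D ε)}

/-- Not prescribed in `DotAction`, but forced by Eᵢ1_λ = Eᵢ1_λ · 1_λ. -/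
theorem act_E_ne (ρ : DotAction M) (i : I) {l k : X} (h : l ≠ k) {m : M}
    (hm : m ∈ weightSpace M k) : ρ.act (Udott.of D (.E i l)) m = 0 := by
  rw [← (Udott_of_sat D).E_one, map_mul, Module.End.mul_apply, ρ.act_one_ne l k h m hm, map_zero]

theorem act_F_ne (ρ : DotAction M) (i : I) {l k : X} (h : l ≠ k) {m : M}
    (hm : m ∈ weightSpace M k) : ρ.act (Udott.of D (.F i l)) m = 0 := by
  rw [← (Udott_of_sat D).F_one, map_mul, Module.End.mul_apply, ρ.act_one_ne l k h m hm, map_zero]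

theorem weightProj (ρ : DotAction M) (hM : IsWeightModule M) :
    WeightProj (weightSpace M) fun l => ρ.act (Udott.of D (.one l)) := by
  obtain ⟨P, hP⟩ := exists_weightProj hM.1 hM.2
  have h : (fun l => ρ.act (Udott.of D (.one l))) = P := by
    funext l
    refine hP.end_ext fun k m hm => ?_
    by_cases hlk : l = k
    · subst hlk
      rw [ρ.act_one l m hm, hP.same hm]
    · rw [ρ.act_one_ne l k hlk m hm, hP.ne hlk hm]
  rw [h]
  exact hP

theorem smul_algebraMap {f : M →+ N} (hf : ∀ (a : UAt D ε) m, f (a • m) = a • f m) (c : AtPi ε)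
    (m : M) : f (c • m) = c • f m := by
  rw [← algebraMap_smul (UAt D ε) c m, hf, algebraMap_smul]

theorem map_weightSpace {f : M →+ N} (hf : ∀ (a : UAt D ε) m, f (a • m) = a • f m) {l : X} {m : M}
    (hm : m ∈ weightSpace M l) : f m ∈ weightSpace N l := by
  refine fun ν => ⟨?_, ?_⟩
  · rw [← hf, K_smul hm, smul_algebraMap hf]
  · rw [← hf, J_smul hm, map_zsmul]

theorem hom_act_of (hM : IsWeightModule M) {f : M →+ N}
    (hf : ∀ (a : UAt D ε) m, f (a • m) = a • f m)
    (ρ : DotAction M) (ρ' : DotAction N) (x : DotGen I X) (m : M) :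
    f (ρ.act (Udott.of D x) m) = ρ'.act (Udott.of D x) (f m) := by
  have hP := ρ.weightProj hM
  suffices h : f.comp (ρ.act (Udott.of D x)).toAddMonoidHom =
      (ρ'.act (Udott.of D x)).toAddMonoidHom.comp f from
    DFunLike.congr_fun h m
  refine hP.hom_ext fun l m hm => ?_
  have hfm := map_weightSpace hf hm
  change f (ρ.act (Udott.of D x) m) = ρ'.act (Udott.of D x) (f m)
  cases x with
  | one k =>
    by_cases hk : k = l
    · subst hk
      rw [ρ.act_one k m hm, ρ'.act_one k _ hfm]
    · rw [ρ.act_one_ne k l hk m hm, ρ'.act_one_ne k l hk _ hfm, map_zero]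
  | E i k =>
    by_cases hk : k = l
    · subst hk
      rw [ρ.act_E i k m hm, ρ'.act_E i k _ hfm, hf]
    · rw [ρ.act_E_ne i hk hm, ρ'.act_E_ne i hk hfm, map_zero]
  | F i k =>
    by_cases hk : k = l
    · subst hk
      rw [ρ.act_F i k m hm, ρ'.act_F i k _ hfm, hf]
    · rw [ρ.act_F_ne i hk hm, ρ'.act_F_ne i hk hfm, map_zero]

/-- Module homomorphisms commute with the action of the modified algebra. -/
theorem hom_act (hM : IsWeightModule M) {f : M →+ N}
    (hf : ∀ (a : UAt D ε) m, f (a • m) = a • f m)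
    (ρ : DotAction M) (ρ' : DotAction N) (u : Udott D) (m : M) :
    f (ρ.act u m) = ρ'.act u (f m) := by
  induction u using Udott_induction generalizing m with
  | of x => exact hom_act_of hM hf ρ ρ' x m
  | zero =>
    exact (congrArg f (LinearMap.congr_fun (map_zero ρ.act) m)).trans
      ((map_zero f).trans (LinearMap.congr_fun (map_zero ρ'.act) (f m)).symm)
  | add u v hu hv =>
    exact (congrArg f (LinearMap.congr_fun (map_add ρ.act u v) m)).trans
      ((map_add f _ _).trans ((congrArg₂ (· + ·) (hu m) (hv m)).trans
        (LinearMap.congr_fun (map_add ρ'.act u v) (f m)).symm))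
  | mul u v hu hv =>
    exact (congrArg f (LinearMap.congr_fun (map_mul ρ.act u v) m)).trans
      ((hu _).trans ((congrArg (ρ'.act u) (hv m)).trans
        (LinearMap.congr_fun (map_mul ρ'.act u v) (f m)).symm))
  | smul c u hu =>
    exact (congrArg f (LinearMap.congr_fun (ρ.act_smul c u) m)).trans
      ((smul_algebraMap hf _ _).trans
        ((congrArg _ (hu m)).trans (LinearMap.congr_fun (ρ'.act_smul c u) (f m)).symm))

theorem act_unique (hM : IsWeightModule M) (ρ ρ' : DotAction M) (u : Udott D) (m : M) :
    ρ.act u m = ρ'.act u m :=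
  hom_act hM (f := AddMonoidHom.id M) (fun _ _ => rfl) ρ ρ' u m

/-- Additive maps that commute with the action of the modified algebra are linear. -/
theorem map_smul_of_act (hM : IsWeightModule M) (hN : IsWeightModule N) (ρ : DotAction M)
    (ρ' : DotAction N) (g : M →+ N)
    (hg : ∀ u m, g (ρ.act u m) = ρ'.act u (g m)) (a : UAt D ε) (m : M) : g (a • m) = a • g m := by
  have hP := ρ.weightProj hM
  have hP' := ρ'.weightProj hN
  -- A weight space is the image of its idempotent 1_λ, so it is preserved.
  have hgm : ∀ {l m}, m ∈ weightSpace M l → g m ∈ weightSpace N l := by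
    intro l m hm
    rw [← ρ.act_one l m hm, hg]
    exact hP'.mem l _
  -- Additivity alone does not give linearity over the field; but a lift of c to ℚ(v,𝐭)^π makes c •
  -- 1_λ an element of 𝐔̇[𝐭] that acts on M_λ as c.
  have hsmul : ∀ (c : AtPi ε) (m : M), g (c • m) = c • g m := by
    intro c m
    suffices h : g.comp (DistribSMul.toAddMonoidHom M c) =
        (DistribSMul.toAddMonoidHom N c).comp g from DFunLike.congr_fun h m
    refine hP.hom_ext fun l m hm => ?_
    obtain ⟨c, rfl⟩ := algebraMap_AtPi_surjective ε c
    change g (algebraMap QvtPi (AtPi ε) c • m) = algebraMap QvtPi (AtPi ε) c • g m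
    have h1 := hg (c • Udott.of D (.one l)) m
    rwa [ρ.act_smul, ρ'.act_smul, LinearMap.smul_apply, LinearMap.smul_apply, ρ.act_one l m hm,
      ρ'.act_one l _ (hgm hm)] at h1
  induction a using UAt_induction generalizing m with
  | of x =>
    suffices h : g.comp (DistribSMul.toAddMonoidHom M (UAt.of D ε x)) =
        (DistribSMul.toAddMonoidHom N (UAt.of D ε x)).comp g from DFunLike.congr_fun h m
    refine hP.hom_ext fun l m hm => ?_
    change g (UAt.of D ε x • m) = UAt.of D ε x • g m
    cases x with
    | E i => rw [← ρ.act_E i l m hm, ← ρ'.act_E i l _ (hgm hm), hg]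
    | F i => rw [← ρ.act_F i l m hm, ← ρ'.act_F i l _ (hgm hm), hg]
    | K ν =>
      exact (congrArg g (K_smul hm ν)).trans ((hsmul _ _).trans (K_smul (hgm hm) ν).symm)
    | J ν =>
      exact (congrArg g (J_smul hm ν)).trans ((map_zsmul g _ _).trans (J_smul (hgm hm) ν).symm)
  | scalar c =>
    exact (congrArg g (smul_one_smul (UAt D ε) c m)).trans
      ((hsmul c m).trans (smul_one_smul (UAt D ε) c (g m)).symm)
  | add a b ha hb =>
    exact (congrArg g (add_smul a b m)).trans ((map_add g _ _).trans
      ((congrArg₂ (· + ·) (ha m) (hb m)).trans (add_smul a b (g m)).symm))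
  | mul a b ha hb =>
    exact (congrArg g (mul_smul a b m)).trans ((ha _).trans
      ((congrArg (a • ·) (hb m)).trans (mul_smul a b (g m)).symm))

end DotAction

end ModuleCat

/-! ### Modules from actions of the modified algebra -/

section ModOfHom

variable {D : SuperRootDatum I Y X} {ε : ℤˣ} {M : Type w} [AddCommGroup M] [Module (AtPi ε) M]
  (φ : UAt D ε →ₐ[AtPi ε] Module.End (AtPi ε) M)

/-- The module given by a representation. -/
def modOfHom : ModuleCat.{w} (UAt D ε) :=
  let _ : Module (UAt D ε) M := Module.compHom M φ.toRingHom
  ModuleCat.of (UAt D ε) M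

/-- The identity map to `modOfHom`. -/
def modOfHomAddEquiv : M ≃+ modOfHom φ := AddEquiv.refl M

theorem smul_modOfHomAddEquiv (a : UAt D ε) (m : M) :
    a • modOfHomAddEquiv φ m = modOfHomAddEquiv φ (φ a m) := rfl

theorem scalar_smul_modOfHomAddEquiv (c : AtPi ε) (m : M) :
    c • modOfHomAddEquiv φ m = modOfHomAddEquiv φ (c • m) := by
  rw [← algebraMap_smul (UAt D ε) c (modOfHomAddEquiv φ m), smul_modOfHomAddEquiv, φ.commutes,
    Module.algebraMap_end_apply]

/-- The identity map to `modOfHom`, as a linear map. -/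
def modOfHomEquiv : M ≃ₗ[AtPi ε] modOfHom φ where
  __ := modOfHomAddEquiv φ
  map_smul' c m := (scalar_smul_modOfHomAddEquiv φ c m).symm

theorem smul_modOfHomEquiv (a : UAt D ε) (m : M) :
    a • modOfHomEquiv φ m = modOfHomEquiv φ (φ a m) := rfl

end ModOfHom

theorem SuperRootDatum.exists_pairing_ne (D : SuperRootDatum I Y X) {l k : X} (h : l ≠ k) :
    ∃ ν : Y, D.pairing ν l ≠ D.pairing ν k := by
  by_contra! hν
  have := D.perfect
  exact h ((LinearMap.IsPerfPair.bijective_right D.pairing).1 (LinearMap.ext hν))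

section OfDot

variable {D : SuperRootDatum I Y X} {ε : ℤˣ} {M : Type w} [AddCommGroup M] [Module (AtPi ε) M]
  {act : Udott D →ₙ+* Module.End (AtPi ε) M}
  (hact : ∀ c u, act (c • u) = algebraMap QvtPi (AtPi ε) c • act u)
  {W : X → Submodule (AtPi ε) M} (hP : WeightProj W fun l => act (Udott.of D (.one l)))

theorem dotSat_act (hact : ∀ c u, act (c • u) = algebraMap QvtPi (AtPi ε) c • act u) :
    DotSat D (specQvPi ε) fun x => act (Udott.of D x) :=
  (Udott_of_sat D).map act hact

/-- The operators of the covering quantum group on a unital module over the modified algebra. -/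
def ofDotOp : Gen I Y → Module.End (AtPi ε) M :=
  uOp D (specQvPi ε) hP (fun i => hP.glue fun l => act (Udott.of D (.E i l)))
    fun i => hP.glue fun l => act (Udott.of D (.F i l))

include hact in
theorem exists_ofDotHom : ∃ f : UAt D ε →ₐ[AtPi ε] Module.End (AtPi ε) M,
    ∀ x, f (UAt.of D ε x) = ofDotOp hP x :=
  exists_uLift (((dotSat_act hact).weightRep hP).uSat hP)

/-- The representation on a unital module over the modified algebra. -/
def ofDotHom : UAt D ε →ₐ[AtPi ε] Module.End (AtPi ε) M := (exists_ofDotHom hact hP).choose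

theorem ofDotHom_of (x : Gen I Y) : ofDotHom hact hP (UAt.of D ε x) = ofDotOp hP x :=
  (exists_ofDotHom hact hP).choose_spec x

/-- A unital module over the modified algebra as a module over the specialization. -/
def ofDot : ModuleCat.{w} (UAt D ε) := modOfHom (ofDotHom hact hP)

/-- The identity map to `ofDot`. -/
def ofDotEquiv : M ≃ₗ[AtPi ε] ofDot hact hP := modOfHomEquiv (ofDotHom hact hP)

theorem of_smul_ofDotEquiv (x : Gen I Y) (m : M) :
    UAt.of D ε x • ofDotEquiv hact hP m = ofDotEquiv hact hP (ofDotOp hP x m) :=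
  (smul_modOfHomEquiv _ _ m).trans
    (congrArg (ofDotEquiv hact hP) (LinearMap.congr_fun (ofDotHom_of hact hP x) m))

theorem ofDotOp_K (ν : Y) {l : X} {m : M} (hm : m ∈ W l) :
    ofDotOp hP (.K ν) m = specQvPi ε (vQvPi ^ D.pairing ν l : QvPiˣ) • m :=
  hP.glue_apply _ hm

theorem ofDotOp_J (ν : Y) {l : X} {m : M} (hm : m ∈ W l) :
    ofDotOp hP (.J ν) m = specQvPi ε (piU Qv ^ D.pairing ν l : QvPiˣ) • m :=
  hP.glue_apply _ hm

theorem ofDotEquiv_mem_weightSpace {l : X} {m : M} (hm : m ∈ W l) :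
    ofDotEquiv hact hP m ∈ weightSpace (ofDot hact hP) l := by
  refine mem_weightSpace_iff.2 fun ν => ⟨?_, ?_⟩
  · rw [of_smul_ofDotEquiv, ofDotOp_K hP ν hm, map_smul]
  · rw [of_smul_ofDotEquiv, ofDotOp_J hP ν hm, map_smul]

/-- The projections commute with every K_ν, so for k ≠ l the k-component of m is an eigenvector for
both v^⟨ν,l⟩ and v^⟨ν,k⟩. By perfectness of the pairing these differ for some ν, hence by a unit,
and the component vanishes. The J_ν, whose eigenvalues are only ±1, are not needed. -/
theorem mem_of_ofDotEquiv_mem {l : X} {m : M}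
    (hm : ofDotEquiv hact hP m ∈ weightSpace (ofDot hact hP) l) : m ∈ W l := by
  set P : X → Module.End (AtPi ε) M := fun l => act (Udott.of D (.one l)) with hPdef
  have hKm : ∀ ν, ofDotOp hP (.K ν) m = specQvPi ε (vQvPi ^ D.pairing ν l : QvPiˣ) • m := by
    intro ν
    apply (ofDotEquiv hact hP).injective
    rw [← of_smul_ofDotEquiv, map_smul]
    exact (mem_weightSpace_iff.1 hm ν).1
  have hcomm : ∀ ν k, P k * ofDotOp hP (.K ν) = ofDotOp hP (.K ν) * P k := by
    intro ν k
    refine hP.end_ext fun j x hx => ?_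
    rw [Module.End.mul_apply, Module.End.mul_apply, ofDotOp_K hP ν hx, map_smul]
    by_cases hkj : k = j
    · subst hkj
      rw [hP.same hx, ofDotOp_K hP ν hx]
    · rw [hP.ne hkj hx, smul_zero, map_zero]
  have hzero : ∀ k, k ≠ l → P k m = 0 := by
    intro k hk
    obtain ⟨ν, hν⟩ := D.exists_pairing_ne hk
    have h1 := LinearMap.congr_fun (hcomm ν k) m
    rw [Module.End.mul_apply, Module.End.mul_apply, hKm, map_smul,
      ofDotOp_K hP ν (hP.mem k m), ← sub_eq_zero, ← sub_smul, specQvPi_v_zpow,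
      specQvPi_v_zpow] at h1
    exact (vAt_zpow_sub_isUnit ε hν.symm).smul_eq_zero.1 h1
  have hsum := hP.sum m
  rw [finsum_eq_single _ l hzero] at hsum
  rw [← hsum]
  exact hP.mem l m

theorem ofDotEquiv_mem_iff {l : X} {m : M} :
    ofDotEquiv hact hP m ∈ weightSpace (ofDot hact hP) l ↔ m ∈ W l :=
  ⟨mem_of_ofDotEquiv_mem hact hP, ofDotEquiv_mem_weightSpace hact hP⟩

theorem weightProj_ofDot : WeightProj (weightSpace (ofDot hact hP))
    fun l => (ofDotEquiv hact hP).conj (act (Udott.of D (.one l))) := by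
  set e := ofDotEquiv hact hP
  have hmem : ∀ {l x}, x ∈ weightSpace (ofDot hact hP) l → e.symm x ∈ W l := fun {l x} hx =>
    mem_of_ofDotEquiv_mem hact hP (by rwa [LinearEquiv.apply_symm_apply])
  refine ⟨fun l x => ?_, fun {l x} hx => ?_, fun {l k} hlk x hx => ?_, fun x => ?_, fun x => ?_⟩
  · exact ofDotEquiv_mem_weightSpace hact hP (hP.mem l (e.symm x))
  · rw [LinearEquiv.conj_apply_apply, hP.same (hmem hx), e.apply_symm_apply]
  · rw [LinearEquiv.conj_apply_apply, hP.ne hlk (hmem hx), map_zero]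
  · refine (hP.finite (e.symm x)).subset fun l hl h0 => hl ?_
    exact (congrArg e h0).trans (map_zero e)
  · refine Eq.trans ?_ (e.apply_symm_apply x)
    rw [← hP.sum (e.symm x)]
    exact (AddMonoidHom.map_finsum e.toLinearMap.toAddMonoidHom (hP.finite (e.symm x))).symm

theorem isWeightModule_ofDot : IsWeightModule (ofDot hact hP) :=
  ⟨(weightProj_ofDot hact hP).iSupIndep, (weightProj_ofDot hact hP).iSup_eq_top⟩

/-- The action of the modified algebra on `ofDot` is the given one. -/
def ofDotAct : Udott D →ₙ+* Module.End (AtPi ε) (ofDot hact hP) where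
  toFun u := (ofDotEquiv hact hP).conj (act u)
  map_mul' u v := (congrArg _ (map_mul act u v)).trans (LinearEquiv.conj_comp _ _ _)
  map_zero' := (congrArg _ (map_zero act)).trans (map_zero _)
  map_add' u v := (congrArg _ (map_add act u v)).trans (map_add _ _ _)

theorem ofDotAct_apply (u : Udott D) (m : M) :
    ofDotAct hact hP u (ofDotEquiv hact hP m) = ofDotEquiv hact hP (act u m) :=
  congrArg (fun x => ofDotEquiv hact hP (act u x)) ((ofDotEquiv hact hP).symm_apply_apply m)

theorem ofDotAct_E {i : I} {l : X} {m : ofDot hact hP} (hm : m ∈ weightSpace (ofDot hact hP) l) :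
    ofDotAct hact hP (Udott.of D (.E i l)) m = UAt.of D ε (.E i) • m := by
  obtain ⟨m, rfl⟩ := (ofDotEquiv hact hP).surjective m
  exact (ofDotAct_apply hact hP _ m).trans ((congrArg (ofDotEquiv hact hP)
    (hP.glue_apply (fun l => act (Udott.of D (.E i l)))
      (mem_of_ofDotEquiv_mem hact hP hm)).symm).trans (of_smul_ofDotEquiv hact hP (.E i) m).symm)

theorem ofDotAct_F {i : I} {l : X} {m : ofDot hact hP} (hm : m ∈ weightSpace (ofDot hact hP) l) :
    ofDotAct hact hP (Udott.of D (.F i l)) m = UAt.of D ε (.F i) • m := by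
  obtain ⟨m, rfl⟩ := (ofDotEquiv hact hP).surjective m
  exact (ofDotAct_apply hact hP _ m).trans ((congrArg (ofDotEquiv hact hP)
    (hP.glue_apply (fun l => act (Udott.of D (.F i l)))
      (mem_of_ofDotEquiv_mem hact hP hm)).symm).trans (of_smul_ofDotEquiv hact hP (.F i) m).symm)

/-- The action of the modified algebra on `ofDot`, as an action on a weight module. -/
def ofDotAction : DotAction (ofDot hact hP) where
  act := ofDotAct hact hP
  act_smul c u := (congrArg (ofDotEquiv hact hP).conj (hact c u)).trans
    (map_smul (ofDotEquiv hact hP).conj _ (act u))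
  act_one _ _ hm := (weightProj_ofDot hact hP).same hm
  act_one_ne _ _ hlk _ hm := (weightProj_ofDot hact hP).ne hlk hm
  act_E _ _ _ hm := ofDotAct_E hact hP hm
  act_F _ _ _ hm := ofDotAct_F hact hP hm

end OfDot

/-! ### Twisting modules by automorphisms of the modified algebra -/

/-- An automorphism of `𝐔̇[𝐭]` by which modules at `π = ε` can be twisted to modules at
`π = ε'`. -/
structure Twist (D : SuperRootDatum I Y X) (ε ε' : ℤˣ) where
  auto : Udott D ≃+* Udott D
  scalar : QvtPi ≃+* QvtPi
  field : AtPi ε' ≃+* AtPi ε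
  auto_smul (c : QvtPi) (u : Udott D) : auto (c • u) = scalar c • auto u
  algebraMap_scalar (c : QvtPi) :
    algebraMap QvtPi (AtPi ε) (scalar c) = field (algebraMap QvtPi (AtPi ε') c)
  auto_one (l : X) : auto (Udott.of D (.one l)) = Udott.of D (.one l)

namespace Twist

variable {D : SuperRootDatum I Y X} {ε ε' : ℤˣ}

/-- The inverse twist. -/
def symm (T : Twist D ε ε') : Twist D ε' ε where
  auto := T.auto.symm
  scalar := T.scalar.symm
  field := T.field.symm
  auto_smul c u := T.auto.injective <| by
    rw [T.auto_smul, RingEquiv.apply_symm_apply, RingEquiv.apply_symm_apply,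
      RingEquiv.apply_symm_apply]
  algebraMap_scalar c := T.field.injective <| by
    rw [← T.algebraMap_scalar, RingEquiv.apply_symm_apply, RingEquiv.apply_symm_apply]
  auto_one l := T.auto.injective <| by rw [RingEquiv.apply_symm_apply, T.auto_one]

section Carrier

variable (T : Twist D ε ε') (M : Type w) [AddCommGroup M] [Module (AtPi ε) M]

/-- The group `M` with scalars twisted. -/
@[nolint unusedArguments]
def Carrier (_ : Twist D ε ε') (M : Type w) : Type w := M

instance : AddCommGroup (T.Carrier M) := inferInstanceAs (AddCommGroup M)

instance : Module (AtPi ε') (T.Carrier M) := Module.compHom M T.field.toRingHom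

/-- The identity map to the twisted group. -/
def toCarrier : M ≃+ T.Carrier M := AddEquiv.refl M

variable {M}

theorem smul_toCarrier (c : AtPi ε') (m : M) :
    c • T.toCarrier M m = T.toCarrier M (T.field c • m) := rfl

/-- An endomorphism as an endomorphism of the twisted space. -/
def carrierEnd (f : Module.End (AtPi ε) M) : Module.End (AtPi ε') (T.Carrier M) where
  toFun := f
  map_add' := map_add f
  map_smul' c m := map_smul f (T.field c) ((T.toCarrier M).symm m)

/-- The twisted action. -/
def carrierAct (act : Udott D →ₙ+* Module.End (AtPi ε) M) :
    Udott D →ₙ+* Module.End (AtPi ε') (T.Carrier M) where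
  toFun u := T.carrierEnd (act (T.auto u))
  map_mul' u v := by rw [map_mul, map_mul]; rfl
  map_zero' := by rw [map_zero, map_zero]; rfl
  map_add' u v := by rw [map_add, map_add]; rfl

variable {act : Udott D →ₙ+* Module.End (AtPi ε) M}

theorem carrierAct_apply (u : Udott D) (m : M) :
    T.carrierAct act u (T.toCarrier M m) = T.toCarrier M (act (T.auto u) m) := rfl

/-- The automorphism turns c into `T.scalar c`, whose specialization at π = ε is `T.field` of the
specialization of c at π = ε'. That is exactly how c acts on the twisted space. -/
theorem carrierAct_smul (hact : ∀ c u, act (c • u) = algebraMap QvtPi (AtPi ε) c • act u)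
    (c : QvtPi) (u : Udott D) :
    T.carrierAct act (c • u) = algebraMap QvtPi (AtPi ε') c • T.carrierAct act u := by
  refine LinearMap.ext fun m => ?_
  obtain ⟨m, rfl⟩ := (T.toCarrier M).surjective m
  rw [LinearMap.smul_apply, carrierAct_apply, carrierAct_apply, smul_toCarrier, T.auto_smul, hact,
    T.algebraMap_scalar, LinearMap.smul_apply]

/-- The twist of a subspace. -/
def carrierSubmodule (W : Submodule (AtPi ε) M) : Submodule (AtPi ε') (T.Carrier M) where
  carrier := {m | (T.toCarrier M).symm m ∈ W}
  zero_mem' := W.zero_mem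
  add_mem' := W.add_mem
  smul_mem' c _ hm := W.smul_mem (T.field c) hm

theorem toCarrier_mem {W : Submodule (AtPi ε) M} {m : M} :
    T.toCarrier M m ∈ T.carrierSubmodule W ↔ m ∈ W := Iff.rfl

/-- The automorphism fixes every 1_λ, so the projections and the decomposition stay the same as maps
and subsets. -/
theorem carrier_weightProj {W : X → Submodule (AtPi ε) M}
    (hP : WeightProj W fun l => act (Udott.of D (.one l))) :
    WeightProj (fun l => T.carrierSubmodule (W l))
      fun l => T.carrierAct act (Udott.of D (.one l)) := by
  have key : (fun l => T.carrierAct act (Udott.of D (.one l))) =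
      fun l => T.carrierEnd (act (Udott.of D (.one l))) := by
    funext l
    exact congrArg (fun u => T.carrierEnd (act u)) (T.auto_one l)
  rw [key]
  exact ⟨fun l m => hP.mem l m, fun {_ _} hm => hP.same hm, fun {_ _} hlk {_} hm => hP.ne hlk hm,
    fun m => hP.finite m, fun m => hP.sum m⟩

variable (hact : ∀ c u, act (c • u) = algebraMap QvtPi (AtPi ε) c • act u)
  {W : X → Submodule (AtPi ε) M} (hP : WeightProj W fun l => act (Udott.of D (.one l)))

/-- A unital module over the modified algebra, twisted and turned into a module over the
specialization. -/
def twistModule : ModuleCat.{w} (UAt D ε') :=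
  ofDot (T.carrierAct_smul hact) (T.carrier_weightProj hP)

/-- The identity map to the twisted module. -/
def toTwistModule : M ≃+ T.twistModule hact hP :=
  (T.toCarrier M).trans
    (ofDotEquiv (T.carrierAct_smul hact) (T.carrier_weightProj hP)).toAddEquiv

theorem toTwistModule_apply (m : M) : T.toTwistModule hact hP m =
    ofDotEquiv (T.carrierAct_smul hact) (T.carrier_weightProj hP) (T.toCarrier M m) := rfl

theorem toTwistModule_mem_weightSpace {l : X} {m : M} :
    T.toTwistModule hact hP m ∈ weightSpace (T.twistModule hact hP) l ↔ m ∈ W l :=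
  (ofDotEquiv_mem_iff (T.carrierAct_smul hact) (T.carrier_weightProj hP)).trans T.toCarrier_mem

theorem toTwistModule_smul (c : AtPi ε) (m : M) :
    T.toTwistModule hact hP (c • m) = T.field.symm c • T.toTwistModule hact hP m := by
  have h : T.toCarrier M (c • m) = T.field.symm c • T.toCarrier M m := by
    rw [smul_toCarrier, RingEquiv.apply_symm_apply]
  rw [toTwistModule_apply, toTwistModule_apply, h]
  exact map_smul (ofDotEquiv (T.carrierAct_smul hact) (T.carrier_weightProj hP)) _ _

/-- The identity map between weight spaces. -/
def weightSpaceMap (l : X) :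
    W l →ₛₗ[T.field.symm.toRingHom] weightSpace (T.twistModule hact hP) l where
  toFun m := ⟨T.toTwistModule hact hP m, (T.toTwistModule_mem_weightSpace hact hP).2 m.2⟩
  map_add' m n := Subtype.ext (map_add (T.toTwistModule hact hP) m.1 n.1)
  map_smul' c m := Subtype.ext (T.toTwistModule_smul hact hP c m)

theorem weightSpaceMap_surjective (l : X) : Function.Surjective (T.weightSpaceMap hact hP l) := by
  rintro ⟨x, hx⟩
  obtain ⟨m, rfl⟩ := (T.toTwistModule hact hP).surjective x
  exact ⟨⟨m, (T.toTwistModule_mem_weightSpace hact hP).1 hx⟩, rfl⟩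

/-- The weight spaces are unchanged as groups, so the support condition is inherited, and finite
dimension passes along the bijective semilinear map `weightSpaceMap`. -/
theorem isCatO_twistModule [Fintype I] (hfin : ∀ l, Module.Finite (AtPi ε) (W l))
    (hW : ∃ S : Finset X, ∀ m, W m ≠ ⊥ → ∃ l ∈ S, ∃ n : I → ℕ, m = l - ∑ i, n i • D.root i) :
    IsCatO D ε' (T.twistModule hact hP) := by
  refine ⟨isWeightModule_ofDot _ _, fun l => ?_, ?_⟩
  · have := hfin l
    exact Module.Finite.of_surjective (T.weightSpaceMap hact hP l)
      (T.weightSpaceMap_surjective hact hP l)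
  · obtain ⟨S, hS⟩ := hW
    refine ⟨S, fun l hl => hS l fun h0 => hl ?_⟩
    rw [Submodule.eq_bot_iff] at h0 ⊢
    intro x hx
    obtain ⟨m, rfl⟩ := (T.toTwistModule hact hP).surjective x
    rw [h0 m ((T.toTwistModule_mem_weightSpace hact hP).1 hx), map_zero]

/-- The twisted action. -/
def twistModuleAction : DotAction (T.twistModule hact hP) :=
  ofDotAction (T.carrierAct_smul hact) (T.carrier_weightProj hP)

theorem twistModuleAction_act (u : Udott D) (m : M) :
    (T.twistModuleAction hact hP).act u (T.toTwistModule hact hP m) =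
      T.toTwistModule hact hP (act (T.auto u) m) :=
  ofDotAct_apply (T.carrierAct_smul hact) (T.carrier_weightProj hP) u (T.toCarrier M m)

end Carrier

end Twist

/-! ### Twisting category `𝓞` -/

section CatO

variable [Fintype I] {D : SuperRootDatum I Y X} {ε ε' : ℤˣ}

/-- The action of the modified algebra on an object of category `𝓞`. -/
def dotAct (M : CatO.{w} D ε) : DotAction M.obj := (exists_dotAction M.property.1).some

theorem dotAct_weightProj (M : CatO.{w} D ε) : WeightProj (weightSpace M.obj)
    fun l => (dotAct M).act (Udott.of D (.one l)) :=
  (dotAct M).weightProj M.property.1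

/-- A homomorphism in category `𝓞` from an additive map that commutes with the actions of the
modified algebra. -/
def homOfAct {M N : CatO.{w} D ε} (g : M.obj →+ N.obj)
    (hg : ∀ u m, g ((dotAct M).act u m) = (dotAct N).act u (g m)) : M ⟶ N :=
  ObjectProperty.homMk (ModuleCat.ofHom
    { g with
      map_smul' := DotAction.map_smul_of_act M.property.1 N.property.1 (dotAct M) (dotAct N) g hg })

theorem catO_hom_ext {M N : CatO.{w} D ε} {f g : M ⟶ N} (h : ∀ m : M.obj, f.hom m = g.hom m) :
    f = g :=
  ObjectProperty.hom_ext _ (ModuleCat.hom_ext (LinearMap.ext h))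

theorem hom_dotAct {M N : CatO.{w} D ε} (f : M ⟶ N) (u : Udott D) (m : M.obj) :
    f.hom ((dotAct M).act u m) = (dotAct N).act u (f.hom m) :=
  DotAction.hom_act M.property.1 (f := f.hom.hom.toAddMonoidHom) (fun a m => map_smul f.hom.hom a m)
    (dotAct M) (dotAct N) u m

/-! ### Functoriality of the twist and its inverse -/

namespace Twist

variable (T : Twist D ε ε')

theorem exists_twist (M : CatO.{w} D ε) : ∃ (N : CatO.{w} D ε') (τ : M.obj ≃+ N.obj),
    ∀ u m, (dotAct N).act u (τ m) = τ ((dotAct M).act (T.auto u) m) := by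
  have hN := T.isCatO_twistModule (dotAct M).act_smul (dotAct_weightProj M)
    M.property.2.1 M.property.2.2
  exact ⟨⟨T.twistModule (dotAct M).act_smul (dotAct_weightProj M), hN⟩,
    T.toTwistModule (dotAct M).act_smul (dotAct_weightProj M), fun u m =>
      -- The action chosen by `dotAct` on the twisted module is not the twisted action by
      -- definition, only by uniqueness.
      (DotAction.act_unique hN.1 _ (T.twistModuleAction (dotAct M).act_smul (dotAct_weightProj M))
        u _).trans (T.twistModuleAction_act (dotAct M).act_smul (dotAct_weightProj M) u m)⟩

/-- The twist of an object of category `𝓞`. -/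
def obj (M : CatO.{w} D ε) : CatO.{w} D ε' := (T.exists_twist M).choose

/-- The map to the twist, an isomorphism of groups. -/
def toTwist (M : CatO.{w} D ε) : M.obj ≃+ (T.obj M).obj := (T.exists_twist M).choose_spec.choose

theorem dotAct_toTwist (M : CatO.{w} D ε) (u : Udott D) (m : M.obj) :
    (dotAct (T.obj M)).act u (T.toTwist M m) = T.toTwist M ((dotAct M).act (T.auto u) m) :=
  (T.exists_twist M).choose_spec.choose_spec u m

/-- The underlying additive map of the twist of a homomorphism. -/
def mapAdd {M N : CatO.{w} D ε} (f : M ⟶ N) : (T.obj M).obj →+ (T.obj N).obj :=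
  (T.toTwist N).toAddMonoidHom.comp (f.hom.hom.toAddMonoidHom.comp
    (T.toTwist M).symm.toAddMonoidHom)

theorem mapAdd_toTwist {M N : CatO.{w} D ε} (f : M ⟶ N) (m : M.obj) :
    T.mapAdd f (T.toTwist M m) = T.toTwist N (f.hom m) :=
  congrArg (fun x => T.toTwist N (f.hom x)) ((T.toTwist M).symm_apply_apply m)

theorem mapAdd_act {M N : CatO.{w} D ε} (f : M ⟶ N) (u : Udott D) (x : (T.obj M).obj) :
    T.mapAdd f ((dotAct (T.obj M)).act u x) = (dotAct (T.obj N)).act u (T.mapAdd f x) := by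
  obtain ⟨m, rfl⟩ := (T.toTwist M).surjective x
  refine (congrArg (T.mapAdd f) (T.dotAct_toTwist M u m)).trans ?_
  refine (T.mapAdd_toTwist f _).trans ?_
  refine (congrArg (T.toTwist N) (hom_dotAct f (T.auto u) m)).trans ?_
  refine (T.dotAct_toTwist N u (f.hom m)).symm.trans ?_
  exact congrArg ((dotAct (T.obj N)).act u) (T.mapAdd_toTwist f m).symm

/-- The twist of a homomorphism. -/
def map {M N : CatO.{w} D ε} (f : M ⟶ N) : T.obj M ⟶ T.obj N :=
  homOfAct (T.mapAdd f) (T.mapAdd_act f)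

theorem map_toTwist {M N : CatO.{w} D ε} (f : M ⟶ N) (m : M.obj) :
    (T.map f).hom (T.toTwist M m) = T.toTwist N (f.hom m) :=
  T.mapAdd_toTwist f m

/-- The twist functor. -/
def functor : CatO.{w} D ε ⥤ CatO.{w} D ε' where
  obj := T.obj
  map := T.map
  map_id M := catO_hom_ext fun x => by
    obtain ⟨m, rfl⟩ := (T.toTwist M).surjective x
    exact T.map_toTwist (𝟙 M) m
  map_comp {M N K} f g := catO_hom_ext fun x => by
    obtain ⟨m, rfl⟩ := (T.toTwist M).surjective x
    refine (T.map_toTwist (f ≫ g) m).trans ?_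
    refine Eq.trans ?_ (congrArg (T.map g).hom (T.map_toTwist f m)).symm
    exact (T.map_toTwist g (f.hom m)).symm

/-- The identity map to the double twist. -/
def toDouble (T' : Twist D ε' ε) (M : CatO.{w} D ε) : M.obj ≃+ (T'.obj (T.obj M)).obj :=
  (T.toTwist M).trans (T'.toTwist (T.obj M))

/-- On the double twist u acts as the composite of both automorphisms applied to u, that is, as u
itself. -/
theorem dotAct_toDouble {T' : Twist D ε' ε} (h : ∀ u, T.auto (T'.auto u) = u) (M : CatO.{w} D ε)
    (u : Udott D) (m : M.obj) :
    T.toDouble T' M ((dotAct M).act u m) =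
      (dotAct (T'.obj (T.obj M))).act u (T.toDouble T' M m) := by
  refine Eq.symm ((T'.dotAct_toTwist (T.obj M) u (T.toTwist M m)).trans ?_)
  refine congrArg (T'.toTwist (T.obj M)) ((T.dotAct_toTwist M (T'.auto u) m).trans ?_)
  exact congrArg (fun v => T.toTwist M ((dotAct M).act v m)) (h u)

/-- The double twist by inverse automorphisms. -/
def doubleIso {T' : Twist D ε' ε} (h : ∀ u, T.auto (T'.auto u) = u) (M : CatO.{w} D ε) :
    M ≅ T'.obj (T.obj M) where
  hom := homOfAct (T.toDouble T' M).toAddMonoidHom (T.dotAct_toDouble h M)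
  inv := homOfAct (T.toDouble T' M).symm.toAddMonoidHom fun u x => by
    obtain ⟨m, rfl⟩ := (T.toDouble T' M).surjective x
    refine (congrArg (T.toDouble T' M).symm (T.dotAct_toDouble h M u m).symm).trans ?_
    refine ((T.toDouble T' M).symm_apply_apply _).trans ?_
    exact congrArg _ ((T.toDouble T' M).symm_apply_apply m).symm
  hom_inv_id := catO_hom_ext fun m => (T.toDouble T' M).symm_apply_apply m
  inv_hom_id := catO_hom_ext fun x => (T.toDouble T' M).apply_symm_apply x

/-- The double twist by inverse automorphisms is isomorphic to the identity. -/
def doubleNatIso {T' : Twist D ε' ε} (h : ∀ u, T.auto (T'.auto u) = u) :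
    𝟭 (CatO.{w} D ε) ≅ T.functor ⋙ T'.functor :=
  NatIso.ofComponents (T.doubleIso h) fun {M N} f => catO_hom_ext fun m => by
    refine Eq.symm ((T'.map_toTwist (T.map f) (T.toTwist M m)).trans ?_)
    exact congrArg (T'.toTwist (T.obj N)) (T.map_toTwist f m)

/-- Twisting is an equivalence of categories. -/
def equivalence : CatO.{w} D ε ≌ CatO.{w} D ε' :=
  CategoryTheory.Equivalence.mk T.functor T.symm.functor
    (T.doubleNatIso fun u => T.auto.apply_symm_apply u)
    (T.symm.doubleNatIso fun u => T.auto.symm_apply_apply u).symm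

end Twist

end CatO

/-! ### The twist by the twistor -/

/-- The automorphism of `ℚ(v,𝐭)^π` that fixes `𝐭` and sends `π` to `-π` and `v` to `𝐭⁻¹ v`. -/
def twistQvtPiEquiv : QvtPi ≃+* QvtPi :=
  RingEquiv.ofRingHom twistQvtPi (twistQvtPi.comp (twistQvtPi.comp twistQvtPi))
    twistQvtPi_comp_four twistQvtPi_comp_four

/-- The twistor, for twisting modules at `π = -1` to modules at `π = 1`. -/
def twistorTwist [Fintype I] [LinearOrder I] (D : SuperRootDatum I Y X) (C : Transversal D) :
    Twist D (-1) 1 where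
  auto := twistor D C
  scalar := twistQvtPiEquiv
  field := twistAt 1 (-1)
  auto_smul := twistorHom_smul D C
  algebraMap_scalar c := twistAt_algebraMap rfl c
  auto_one := (isTwistor_twistor D C).map_one

end CoveringQG

end

theorem corollary4p7 {I Y X : Type*} [Fintype I] [LinearOrder I]
    [AddCommGroup Y] [Module.Free ℤ Y] [Module.Finite ℤ Y]
    [AddCommGroup X] [Module.Free ℤ X] [Module.Finite ℤ X]
    (D : CoveringQG.SuperRootDatum I Y X) (C : CoveringQG.Transversal D) :
    ∃ Ψ : CoveringQG.Udott D ≃+* CoveringQG.Udott D, CoveringQG.IsTwistor D C Ψ ∧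
      ∃ (e : CoveringQG.CatO.{w} D 1 ≌ CoveringQG.CatO.{w} D (-1))
        (ρ₁ : ∀ M : CoveringQG.CatO.{w} D 1, CoveringQG.DotAction M.obj)
        (ρ₂ : ∀ M : CoveringQG.CatO.{w} D (-1), CoveringQG.DotAction M.obj)
        (τ : ∀ M : CoveringQG.CatO.{w} D 1, M.obj ≃+ (e.functor.obj M).obj),
        (∀ (M N : CoveringQG.CatO.{w} D 1) (f : M ⟶ N) (m : M.obj),
          τ N (f.hom m) = (e.functor.map f).hom (τ M m)) ∧
        ∀ (M : CoveringQG.CatO.{w} D 1) (u : CoveringQG.Udott D) (m : M.obj),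
          τ M ((ρ₁ M).act u m) = (ρ₂ (e.functor.obj M)).act (Ψ u) (τ M m) := by
  -- Twisting pulls actions back along the automorphism. For Ψ(u) on the twisted module to match u
  -- on M, the pullback has to be along Ψ⁻¹, which also goes from π = 1 to π = -1.
  let T := (CoveringQG.twistorTwist D C).symm
  refine ⟨CoveringQG.twistor D C, CoveringQG.isTwistor_twistor D C, T.equivalence,
    CoveringQG.dotAct, CoveringQG.dotAct, T.toTwist, fun M N f m => (T.map_toTwist f m).symm,
    fun M u m => ?_⟩
  refine Eq.symm ((T.dotAct_toTwist M (CoveringQG.twistor D C u) m).trans ?_)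
  exact congrArg (fun v => T.toTwist M ((CoveringQG.dotAct M).act v m))
    ((CoveringQG.twistor D C).symm_apply_apply u)
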